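/- **Setting.** Let $\mathcal X,\mathcal Y_1,\mathcal Y_2$ be finite alphabets and let $P=P_{XY_1Y_2}$ and $\bar P=\bar P_{XY_1Y_2}$ be pmfs on $\mathcal X\times\mathcal Y_1\times\mathcal Y_2$. Under hypothesis $\mathcal H=0$ the triples $(X_t,Y_{1,t},Y_{2,t})_{t=1}^n$ are i.i.d. $\sim P$, under $\mathcal H=1$ they are i.i.d. $\sim\bar P$. A sensor sends $M_1=\phi_{1,n}(X^n)\in\{0,\dots,\mathsf W_{1,n}-1\}$ to both detectors. Detector 1 sends $M_2=\phi_{2,n}(M_1,Y_1^n)\in\{0,\dots,\mathsf W_{2,n}-1\}$ to Detector 2 and guesses $\hat{\mathcal H}_1=\psi_{1,n}(M_1,Y_1^n)\in\{0,1\}$. Detector 2 guesses $\hat{\mathcal H}_2=\psi_{2,n}(M_1,M_2,Y_2^n)\in\{0,1\}$. In concurrent detection ($\bar h_1=0$) the error probabilities are $$\alpha_{1,n}=\Pr\{\hat{\mathcal H}_1=0\mid\mathcal H=1\},\quad \beta_{1,n}=\Pr\{\hat{\mathcal H}_1=1\mid\mathcal H=0\},$$ $$\alpha_{2,n}=\Pr\{\hat{\mathcal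 H}_2=1\mid\mathcal H=0\},\quad \beta_{2,n}=\Pr\{\hat{\mathcal H}_2=0\mid\mathcal H=1\}.$$ For $R_1,R_2\ge 0$, a pair $(\theta_1,\theta_2)$ of real numbers is achievable if there are functions $\phi_{1,n},\phi_{2,n},\psi_{1,n},\psi_{2,n}$ for all blocklengths $n$ such that, for $i=1,2$, $$\varlimsup_{n\to\infty}\alpha_{i,n}\le 0,\qquad \theta_i\le\varliminf_{n\to\infty}-\tfrac1n\log\beta_{i,n},\qquad \varlimsup_{n\to\infty}\tfrac1n\log\mathsf W_{i,n}\le R_i,$$ where $-\log 0=+\infty$. The error-exponents region $\mathcal E(R_1,R_2)$ is the closure in $\mathbb R^2$ of the set of achievable pairs. All logarithms, including those in the information measures, have the same base. **Auxiliary variables.** Let $(X,Y_1,Y_2)\sim P$ and $(\bar X,\bar Y_1,\bar Y_2)\sim\bar P$. Let $\mathcal S(R_1,R_2)$ be the set of pairs $(U,V)$ of random variables with finite alphabets, jointly distributed with $(X,Y_1,Y_2)$, such that $U - X - (Y_1,Y_2)$ and $V - (Y_1,U) - (Y_2,X)$ are Markov chains, $I(U;X)\le R_1$ and $I(V;Y_1|U)\le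 R_2$. For such a pair let $(\bar U,\bar V)$ satisfy $P_{\bar U|\bar X}=P_{U|X}$ and $P_{\bar V|\bar Y_1\bar U}=P_{V|Y_1U}$ (wherever both conditional pmfs are defined) and the Markov chains $\bar U - \bar X - (\bar Y_1,\bar Y_2)$ and $\bar V - (\bar Y_1,\bar U) - (\bar X,\bar Y_2)$; let $\bar P_{UX}$ and $\bar P_{UY_1}$ be the pmfs of $(\bar U,\bar X)$ and $(\bar U,\bar Y_1)$. Let $$\overline{\mathcal L}_1(U)=\{(\tilde U,\tilde X,\tilde Y_1):\ P_{\tilde U\tilde X}=\bar P_{UX},\ P_{\tilde U\tilde Y_1}=\bar P_{UY_1}\},$$ $$\mathcal L_2(UV)=\{(\tilde U,\tilde V,\tilde X,\tilde Y_1,\tilde Y_2):\ P_{\tilde U\tilde X}=P_{UX},\ P_{\tilde U\tilde V\tilde Y_1}=P_{UVY_1},\ P_{\tilde U\tilde V\tilde Y_2}=P_{UVY_2}\}.$$ $D(\cdot\|\cdot)$ is the Kullback–Leibler divergence of the laws, equal to $+\infty$ without absolute continuity. **Theorem (Concurrent detection with $P_X=\bar P_X$).** Let $\bar h_1=0$,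 $P_X=\bar P_X$ and $R_1,R_2\ge 0$. Then $\mathcal E(R_1,R_2)$ contains all pairs $(\theta_1,\theta_2)$ of nonnegative real numbers that for some $(U,V)\in\mathcal S(R_1,R_2)$ satisfy $$\theta_1\le\min_{(\tilde U,\tilde X,\tilde Y_1)\in\overline{\mathcal L}_1(U)}D(\tilde U\tilde X\tilde Y_1\|UXY_1),$$ $$\theta_2\le\min_{(\tilde U,\tilde V,\tilde X,\tilde Y_1,\tilde Y_2)\in\mathcal L_2(UV)}D(\tilde V\tilde U\tilde X\tilde Y_1\tilde Y_2\|\bar V\bar U\bar X\bar Y_1\bar Y_2).$$ -/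

import Mathlib

open scoped ENNReal
open Filter

noncomputable section

namespace DHT

/-! ### The distributed hypothesis testing problem

A pmf on a finite alphabet is a `PMF`. All logarithms are natural, in rates as well as in exponents. -/

section Problem

variable {𝒳 𝒴₁ 𝒴₂ : Type*}

/-- A coding and testing scheme for blocklength `n`: the message alphabet sizes, the encoders of the
sensor and of Detector 1, and the decision functions of the two detectors. The sensor observes
`x : Fin n → 𝒳` and Detector `i` observes `yᵢ : Fin n → 𝒴ᵢ`. -/
structure Scheme (𝒳 𝒴₁ 𝒴₂ : Type*) (n : ℕ) where
  /-- size of the alphabet of the sensor's message -/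
  W₁ : ℕ
  /-- size of the alphabet of the cooperation message -/
  W₂ : ℕ
  /-- encoder of the sensor -/
  φ₁ : (Fin n → 𝒳) → Fin W₁
  /-- encoder of Detector 1 -/
  φ₂ : Fin W₁ → (Fin n → 𝒴₁) → Fin W₂
  /-- decision of Detector 1 -/
  ψ₁ : Fin W₁ → (Fin n → 𝒴₁) → Fin 2
  /-- decision of Detector 2 -/
  ψ₂ : Fin W₁ → Fin W₂ → (Fin n → 𝒴₂) → Fin 2

/-- The guess of Detector 1 when the sources emit `s`. -/
def Scheme.guess₁ {n : ℕ} (c : Scheme 𝒳 𝒴₁ 𝒴₂ n) (s : Fin n → 𝒳 × 𝒴₁ × 𝒴₂) : Fin 2 :=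
  c.ψ₁ (c.φ₁ fun t => (s t).1) fun t => (s t).2.1

/-- The guess of Detector 2 when the sources emit `s`. -/
def Scheme.guess₂ {n : ℕ} (c : Scheme 𝒳 𝒴₁ 𝒴₂ n) (s : Fin n → 𝒳 × 𝒴₁ × 𝒴₂) : Fin 2 :=
  c.ψ₂ (c.φ₁ fun t => (s t).1) (c.φ₂ (c.φ₁ fun t => (s t).1) fun t => (s t).2.1)
    fun t => (s t).2.2

/-- The probability of the event `A` when the `n` components are i.i.d. with pmf `P`. -/
def iidProb {α : Type*} [Fintype α] (P : PMF α) {n : ℕ} (A : Set (Fin n → α)) : ℝ≥0∞ :=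
  ∑ s : Fin n → α, A.indicator (fun s => ∏ t, P (s t)) s

/-- The source law under hypothesis `h`: it is `P` under `h = 0` and `Pbar` under `h = 1`. -/
def law {α : Type*} (P Pbar : PMF α) (h : Fin 2) : PMF α :=
  if h = 0 then P else Pbar

variable [Fintype 𝒳] [Fintype 𝒴₁] [Fintype 𝒴₂]

/-- `α₁ = Pr (Ĥ₁ = h̄₁ | H = h₁)`, where `h₁ = h̄₁ + 1` modulo `2`. -/
def typeI₁ (h₁bar : Fin 2) (P Pbar : PMF (𝒳 × 𝒴₁ × 𝒴₂)) {n : ℕ} (c : Scheme 𝒳 𝒴₁ 𝒴₂ n) : ℝ≥0∞ :=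
  iidProb (law P Pbar (h₁bar + 1)) {s | c.guess₁ s = h₁bar}

/-- `β₁ = Pr (Ĥ₁ = h₁ | H = h̄₁)`, where `h₁ = h̄₁ + 1` modulo `2`. -/
def typeII₁ (h₁bar : Fin 2) (P Pbar : PMF (𝒳 × 𝒴₁ × 𝒴₂)) {n : ℕ} (c : Scheme 𝒳 𝒴₁ 𝒴₂ n) : ℝ≥0∞ :=
  iidProb (law P Pbar h₁bar) {s | c.guess₁ s = h₁bar + 1}

/-- `α₂ = Pr (Ĥ₂ = 1 | H = 0)`. -/
def typeI₂ (P Pbar : PMF (𝒳 × 𝒴₁ × 𝒴₂)) {n : ℕ} (c : Scheme 𝒳 𝒴₁ 𝒴₂ n) : ℝ≥0∞ :=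
  iidProb (law P Pbar 0) {s | c.guess₂ s = 1}

/-- `β₂ = Pr (Ĥ₂ = 0 | H = 1)`. -/
def typeII₂ (P Pbar : PMF (𝒳 × 𝒴₁ × 𝒴₂)) {n : ℕ} (c : Scheme 𝒳 𝒴₁ 𝒴₂ n) : ℝ≥0∞ :=
  iidProb (law P Pbar 1) {s | c.guess₂ s = 0}

/-- The exponents pair `θ` is achievable under the rates `R₁, R₂`. The exponent `-(1/n) log β` is
extended-real valued: it is `⊤` if `β = 0`. -/
def Achievable (h₁bar : Fin 2) (P Pbar : PMF (𝒳 × 𝒴₁ × 𝒴₂)) (R₁ R₂ : ℝ) (θ : ℝ × ℝ) : Prop :=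
  ∃ c : ∀ n : ℕ, Scheme 𝒳 𝒴₁ 𝒴₂ n,
    limsup (fun n => typeI₁ h₁bar P Pbar (c n)) atTop ≤ 0 ∧
    limsup (fun n => typeI₂ P Pbar (c n)) atTop ≤ 0 ∧
    (θ.1 : EReal) ≤
      liminf (fun n => -ENNReal.log (typeII₁ h₁bar P Pbar (c n)) / (n : EReal)) atTop ∧
    (θ.2 : EReal) ≤ liminf (fun n => -ENNReal.log (typeII₂ P Pbar (c n)) / (n : EReal)) atTop ∧
    limsup (fun n => ((Real.log (c n).W₁ / n : ℝ) : EReal)) atTop ≤ (R₁ : EReal) ∧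
    limsup (fun n => ((Real.log (c n).W₂ / n : ℝ) : EReal)) atTop ≤ (R₂ : EReal)

/-- The error-exponents region: the closure of the set of achievable exponents pairs. -/
def exponentsRegion (h₁bar : Fin 2) (P Pbar : PMF (𝒳 × 𝒴₁ × 𝒴₂)) (R₁ R₂ : ℝ) : Set (ℝ × ℝ) :=
  closure {θ | Achievable h₁bar P Pbar R₁ R₂ θ}

end Problem

/-! ### Information measures

Random variables are functions on a finite sample space with pmf `Q`; the law of `f` is
`Q.map f`. -/

section Information

variable {Ω α β γ : Type*}

/-- The law of the pair `(f, g)`. -/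
def law₂ (Q : PMF Ω) (f : Ω → α) (g : Ω → β) : PMF (α × β) :=
  Q.map fun ω => (f ω, g ω)

/-- The law of the triple `(f, g, h)`. -/
def law₃ (Q : PMF Ω) (f : Ω → α) (g : Ω → β) (h : Ω → γ) : PMF (α × β × γ) :=
  Q.map fun ω => (f ω, g ω, h ω)

/-- Kullback-Leibler divergence of two pmfs; it is `⊤` unless `P ≪ Q`. -/
def kl (P Q : PMF α) : ℝ≥0∞ :=
  letI : MeasurableSpace α := ⊤
  InformationTheory.klDiv P.toMeasure Q.toMeasure

/-- Shannon entropy of a pmf on a finite alphabet. -/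
def entropy [Fintype α] (P : PMF α) : ℝ :=
  ∑ a, Real.negMulLog (P a).toReal

/-- `I(f; g) = H(f) + H(g) - H(f, g)`. -/
def mutualInfo [Fintype α] [Fintype β] (Q : PMF Ω) (f : Ω → α) (g : Ω → β) : ℝ :=
  entropy (Q.map f) + entropy (Q.map g) - entropy (law₂ Q f g)

/-- `I(f; g | h) = H(f, h) + H(g, h) - H(f, g, h) - H(h)`. -/
def condMutualInfo [Fintype α] [Fintype β] [Fintype γ] (Q : PMF Ω)
    (f : Ω → α) (g : Ω → β) (h : Ω → γ) : ℝ :=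
  entropy (law₂ Q f h) + entropy (law₂ Q g h) - entropy (law₃ Q f g h) - entropy (Q.map h)

/-- The Markov chain `f - g - h`: given `g`, the variables `f` and `h` are independent. -/
def IsMarkov (Q : PMF Ω) (f : Ω → α) (g : Ω → β) (h : Ω → γ) : Prop :=
  ∀ a b c, law₃ Q f g h (a, b, c) * Q.map g b = law₂ Q f g (a, b) * law₂ Q g h (b, c)

/-- The conditional pmf of `f` given `g = b` is the same under `Q` and under `Qbar`, for each `b`
that has positive probability under both. -/
def SameCond (Q Qbar : PMF Ω) (f : Ω → α) (g : Ω → β) : Prop :=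
  ∀ a b, law₂ Qbar f g (a, b) * Q.map g b = law₂ Q f g (a, b) * Qbar.map g b

end Information

/-! ### Auxiliary random variables and the sets in the exponents -/

section Auxiliary

variable {𝒰 𝒱 𝒳 𝒴₁ 𝒴₂ : Type*}

/-- The values of the tuple `(U, V, X, Y₁, Y₂)`. -/
abbrev Tuple (𝒰 𝒱 𝒳 𝒴₁ 𝒴₂ : Type*) := 𝒰 × 𝒱 × 𝒳 × 𝒴₁ × 𝒴₂

/-- The coordinate `U`. -/
def U (ω : Tuple 𝒰 𝒱 𝒳 𝒴₁ 𝒴₂) : 𝒰 := ω.1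

/-- The coordinate `V`. -/
def V (ω : Tuple 𝒰 𝒱 𝒳 𝒴₁ 𝒴₂) : 𝒱 := ω.2.1

/-- The coordinate `X`. -/
def X (ω : Tuple 𝒰 𝒱 𝒳 𝒴₁ 𝒴₂) : 𝒳 := ω.2.2.1

/-- The coordinate `Y₁`. -/
def Y₁ (ω : Tuple 𝒰 𝒱 𝒳 𝒴₁ 𝒴₂) : 𝒴₁ := ω.2.2.2.1

/-- The coordinate `Y₂`. -/
def Y₂ (ω : Tuple 𝒰 𝒱 𝒳 𝒴₁ 𝒴₂) : 𝒴₂ := ω.2.2.2.2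

/-- The two Markov chains `U - X - (Y₁, Y₂)` and `V - (Y₁, U) - (Y₂, X)`. -/
def MarkovChains (Q : PMF (Tuple 𝒰 𝒱 𝒳 𝒴₁ 𝒴₂)) : Prop :=
  IsMarkov Q U X (fun ω => (Y₁ ω, Y₂ ω)) ∧
    IsMarkov Q V (fun ω => (Y₁ ω, U ω)) (fun ω => (Y₂ ω, X ω))

/-- `Q` is the joint pmf of `(U, V, X, Y₁, Y₂)` for a pair `(U, V)` in the set `S(R₁, R₂)` that
belongs to `(X, Y₁, Y₂) ∼ P`. -/
structure IsAuxiliary [Fintype 𝒰] [Fintype 𝒱] [Fintype 𝒳] [Fintype 𝒴₁]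
    (P : PMF (𝒳 × 𝒴₁ × 𝒴₂)) (R₁ R₂ : ℝ) (Q : PMF (Tuple 𝒰 𝒱 𝒳 𝒴₁ 𝒴₂)) : Prop where
  marginal : law₃ Q X Y₁ Y₂ = P
  markov : MarkovChains Q
  rate₁ : mutualInfo Q U X ≤ R₁
  rate₂ : condMutualInfo Q V Y₁ U ≤ R₂

/-- `Qbar` is the joint pmf of `(Ū, V̄, X̄, Ȳ₁, Ȳ₂)`, where `(X̄, Ȳ₁, Ȳ₂) ∼ Pbar` and the pair
`(Ū, V̄)` has the same conditional pmfs given `X̄` and given `(Ȳ₁, Ū)` as under `Q`, and satisfies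
the same Markov chains. -/
structure IsAlternative (Q : PMF (Tuple 𝒰 𝒱 𝒳 𝒴₁ 𝒴₂)) (Pbar : PMF (𝒳 × 𝒴₁ × 𝒴₂))
    (Qbar : PMF (Tuple 𝒰 𝒱 𝒳 𝒴₁ 𝒴₂)) : Prop where
  marginal : law₃ Qbar X Y₁ Y₂ = Pbar
  condU : SameCond Q Qbar U X
  condV : SameCond Q Qbar V (fun ω => (Y₁ ω, U ω))
  markov : MarkovChains Qbar

/-- The set `L̄₁(U)` of laws of `(Ũ, X̃, Ỹ₁)` with `(Ũ, X̃) ∼ P̄_{UX}` and `(Ũ, Ỹ₁) ∼ P̄_{UY₁}`,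
where `Qbar` is the joint pmf of `(Ū, V̄, X̄, Ȳ₁, Ȳ₂)`. -/
def L₁bar (Qbar : PMF (Tuple 𝒰 𝒱 𝒳 𝒴₁ 𝒴₂)) : Set (PMF (𝒰 × 𝒳 × 𝒴₁)) :=
  {T | law₂ T (fun ω => ω.1) (fun ω => ω.2.1) = law₂ Qbar U X ∧
    law₂ T (fun ω => ω.1) (fun ω => ω.2.2) = law₂ Qbar U Y₁}

/-- The set `L₂(UV)` of laws of `(Ũ, Ṽ, X̃, Ỹ₁, Ỹ₂)` that share with `Q` the marginals of
`(U, X)`, `(U, V, Y₁)` and `(U, V, Y₂)`. -/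
def L₂ (Q : PMF (Tuple 𝒰 𝒱 𝒳 𝒴₁ 𝒴₂)) : Set (PMF (Tuple 𝒰 𝒱 𝒳 𝒴₁ 𝒴₂)) :=
  {T | law₂ T U X = law₂ Q U X ∧ law₃ T U V Y₁ = law₃ Q U V Y₁ ∧
    law₃ T U V Y₂ = law₃ Q U V Y₂}

end Auxiliary

end DHT

end

/-! The scheme quantizes on two levels and then tests typicality. The sensor describes `x` by a
codeword `u` from about `exp (n I(U;X))` words of law `P_U`; given `u`, Detector 1 describes `y₁` by
a word `v` from about `exp (n I(V;Y₁|U))` words of law `P_{V|U}`. Detector 1 declares 1 when `(u,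
y₁)` is typical for the alternative law of `(Ū, Ȳ₁)`; Detector 2 declares 0 when `(u, v, y₂)` is
typical for `P_{UVY₂}`. The detectors have their type I errors under opposite hypotheses. One sensor
codebook serves both because `P_X` and the alternative marginal of `X` agree, hence so do the laws
of `(U, X)` (`law₂_U_X_eq`).

Good codebooks exist by averaging. A random codebook rarely misses an acceptable word
(`codebook_miss_le`). No Markov lemma is needed: an encoder accepts a word only if, conditionally on
its own observation, the later tests seldom fail, and Markov's inequality shows that this
restriction costs little (`exists_codebook`). The type II probabilities, multiplied by weights of
order `exp (n (θ - ε))`, enter the same average as the failure probabilities, so that one code is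
good in all four respects (`exists_code`).

For the exponents, a union bound runs over the codewords. Typicality replaces the codeword law by
the test channel at the price of a factor close to `exp (-n I)`, which cancels the number of
codewords up to an arbitrarily small exponent. What remains is the i.i.d. probability, under the law
of `(U, X, Y₁)` or that of `(Ū, V̄, X̄, Ȳ₁, Ȳ₂)`, that the empirical marginals checked by the
terminals are close to their targets. Counting types (`sum_iid_le_of_div`) and compactness
(`exists_div_gt`) bound it by the minimal divergence over `L₁bar` or `L₂`. Letting `ε` tend to `0`
along the blocklengths (`exists_diagonal`) yields achievability. -/

namespace DHT

open scoped Topology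

/-! ### Indicators -/

open scoped Classical in
/-- The real indicator of a proposition. -/
noncomputable def ind (p : Prop) : ℝ := if p then 1 else 0

lemma ind_of {p : Prop} (h : p) : ind p = 1 := by simp [ind, h]

lemma ind_of_not {p : Prop} (h : ¬ p) : ind p = 0 := by simp [ind, h]

lemma ind_nonneg (p : Prop) : 0 ≤ ind p := by unfold ind; split_ifs <;> norm_num

lemma ind_mono {p q : Prop} (h : p → q) : ind p ≤ ind q := by
  by_cases hp : p
  · rw [ind_of hp, ind_of (h hp)]
  · rw [ind_of_not hp]; exact ind_nonneg q

lemma ind_and (p q : Prop) : ind (p ∧ q) = ind p * ind q := by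
  by_cases hp : p <;> by_cases hq : q <;> simp [ind, hp, hq]

lemma ind_not (p : Prop) : ind (¬ p) = 1 - ind p := by
  by_cases hp : p <;> simp [ind, hp]

lemma ind_le_add {p q r : Prop} (h : p → q ∨ r) : ind p ≤ ind q + ind r := by
  by_cases hp : p
  · rcases h hp with hq | hr
    · rw [ind_of hp, ind_of hq]; linarith [ind_nonneg r]
    · rw [ind_of hp, ind_of hr]; linarith [ind_nonneg q]
  · rw [ind_of_not hp]; linarith [ind_nonneg q, ind_nonneg r]

lemma ind_exists_le {ι : Type*} [Fintype ι] (p : ι → Prop) : ind (∃ i, p i) ≤ ∑ i, ind (p i) := by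
  by_cases h : ∃ i, p i
  · obtain ⟨i, hi⟩ := h
    rw [ind_of ⟨i, hi⟩, ← ind_of hi]
    exact Finset.single_le_sum (f := fun i => ind (p i)) (fun i _ => ind_nonneg _)
      (Finset.mem_univ i)
  · rw [ind_of_not h]
    exact Finset.sum_nonneg fun i _ => ind_nonneg _

lemma ind_forall {ι : Type*} [Fintype ι] (p : ι → Prop) : ind (∀ i, p i) = ∏ i, ind (p i) := by
  by_cases h : ∀ i, p i
  · rw [ind_of h]; exact (Finset.prod_eq_one fun i _ => ind_of (h i)).symm
  · rw [ind_of_not h]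
    push Not at h
    obtain ⟨i, hi⟩ := h
    exact (Finset.prod_eq_zero (Finset.mem_univ i) (ind_of_not hi)).symm

lemma sum_ind_eq {α : Type*} [Fintype α] (a : α) (f : α → ℝ) : ∑ b, ind (a = b) * f b = f a := by
  rw [Finset.sum_eq_single a]
  · rw [ind_of rfl, one_mul]
  · intro b _ hb
    rw [ind_of_not (Ne.symm hb), zero_mul]
  · simp

lemma sum_fiber {Ω α : Type*} [Fintype Ω] [Fintype α] (Y : Ω → α) (H : α → Ω → ℝ) :
    ∑ y, ∑ ω, ind (Y ω = y) * H y ω = ∑ ω, H (Y ω) ω := by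
  rw [Finset.sum_comm]
  exact Finset.sum_congr rfl fun ω _ => sum_ind_eq (Y ω) fun y => H y ω

lemma sum_ind_some_le_one {M : ℕ} (o : Option (Fin M)) : ∑ j, ind (o = some j) ≤ 1 := by
  cases o with
  | none => simp [ind]
  | some i =>
    have := sum_ind_eq i fun _ => (1 : ℝ)
    simp only [mul_one] at this
    simp [this]

/-! ### Random codebooks -/

section Covering

variable {S C : Type*} [Fintype S] [Fintype C]

lemma sum_prod_codebook (k : C → ℝ) (hk1 : ∑ c, k c = 1) (M : ℕ) :
    ∑ cb : Fin M → C, ∏ j, k (cb j) = 1 := by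
  rw [← Fintype.sum_pow, hk1, one_pow]

lemma sum_codebook_sum (k : C → ℝ) (hk1 : ∑ c, k c = 1) (B : C → ℝ) (M : ℕ) :
    ∑ cb : Fin M → C, (∏ j, k (cb j)) * ∑ j, B (cb j) = M * ∑ c, k c * B c := by
  classical
  simp_rw [Finset.mul_sum]
  rw [Finset.sum_comm]
  have key : ∀ j : Fin M, ∑ cb : Fin M → C, (∏ i, k (cb i)) * B (cb j) = ∑ c, k c * B c := by
    intro j
    have h := Finset.prod_univ_sum (fun _ : Fin M => (Finset.univ : Finset C))
      (fun i c => k c * if i = j then B c else 1)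
    rw [Fintype.piFinset_univ] at h
    have hl : ∏ i : Fin M, ∑ c, k c * (if i = j then B c else 1) = ∑ c, k c * B c := by
      rw [Finset.prod_eq_single j]
      · simp
      · intro i _ hi
        simp [hi, hk1]
      · simp
    rw [← hl, h]
    refine Finset.sum_congr rfl fun cb _ => ?_
    rw [Finset.prod_mul_distrib]
    simp
  simp [key, Finset.mul_sum]

/-- Let `q` be the `w`-mass of `G`. Its `k`-mass is at least `q / K`, so `M` independent words all
miss with probability at most `(1 - q / K) ^ M ≤ exp (-q M / K)`. Convexity of `exp` on the segment
from `0` to `-M / K` bounds this by `(1 - q) + q exp (-M / K)`. -/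
lemma codebook_miss_le (w k : C → ℝ) (hw : ∀ c, 0 ≤ w c) (hw1 : ∑ c, w c = 1)
    (hk : ∀ c, 0 ≤ k c) (hk1 : ∑ c, k c = 1) (G : C → Prop) {K : ℝ} (hK : 0 < K)
    (hG : ∀ c, G c → w c ≤ K * k c) (M : ℕ) :
    ∑ cb : Fin M → C, (∏ j, k (cb j)) * ind (∀ j, ¬ G (cb j)) ≤
      ∑ c, w c * ind (¬ G c) + Real.exp (-(M / K)) := by
  simp_rw [ind_forall, ← Finset.prod_mul_distrib]
  rw [← Fintype.sum_pow (fun c => k c * ind (¬ G c)) M]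
  set q := ∑ c, w c * ind (G c) with hq
  have hq0 : 0 ≤ q := Finset.sum_nonneg fun c _ => mul_nonneg (hw c) (ind_nonneg _)
  have hmiss : ∑ c, w c * ind (¬ G c) = 1 - q := by
    simp_rw [ind_not, mul_sub, mul_one, Finset.sum_sub_distrib, hw1, hq]
  have hq1 : q ≤ 1 := by
    have : 0 ≤ ∑ c, w c * ind (¬ G c) :=
      Finset.sum_nonneg fun c _ => mul_nonneg (hw c) (ind_nonneg _)
    linarith
  have hkq : ∑ c, k c * ind (¬ G c) ≤ 1 - q / K := by
    simp_rw [ind_not, mul_sub, mul_one, Finset.sum_sub_distrib, hk1]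
    have : q / K ≤ ∑ c, k c * ind (G c) := by
      rw [div_le_iff₀ hK, hq, Finset.sum_mul]
      refine Finset.sum_le_sum fun c _ => ?_
      by_cases hc : G c
      · rw [ind_of hc]; linarith [hG c hc]
      · rw [ind_of_not hc]; simp
    linarith
  have hk0 : 0 ≤ ∑ c, k c * ind (¬ G c) :=
    Finset.sum_nonneg fun c _ => mul_nonneg (hk c) (ind_nonneg _)
  have h1 : ∑ c, k c * ind (¬ G c) ≤ Real.exp (-(q / K)) := by
    linarith [Real.add_one_le_exp (-(q / K))]
  have h2 : (∑ c, k c * ind (¬ G c)) ^ M ≤ Real.exp (q * -(M / K)) := by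
    refine (pow_le_pow_left₀ hk0 h1 M).trans_eq ?_
    rw [← Real.exp_nat_mul]
    congr 1
    ring
  have h3 := convexOn_exp.2 (Set.mem_univ (-(M / K : ℝ))) (Set.mem_univ 0) hq0
    (sub_nonneg.2 hq1) (by ring)
  simp only [smul_eq_mul, mul_zero, add_zero, Real.exp_zero, mul_one] at h3
  rw [hmiss]
  have h4 : q * Real.exp (-(M / K)) ≤ Real.exp (-(M / K)) :=
    mul_le_of_le_one_left (Real.exp_pos _).le hq1
  linarith

/-- First moment method: the right side dominates the average of the left side over i.i.d. words of
law `k`. The function `g` is a loss incurred after `c` has been chosen for `s`; the threshold `η * μ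
s` lets the encoder refuse words with a large loss. The function `B` is a price for having `c` in
the codebook at all, and later carries the type II errors. -/
theorem exists_codebook (μ : S → ℝ) (hμ : ∀ s, 0 ≤ μ s)
    (w : S → C → ℝ) (hw : ∀ s c, 0 ≤ w s c) (hw1 : ∀ s, ∑ c, w s c = 1)
    (k : C → ℝ) (hk : ∀ c, 0 ≤ k c) (hk1 : ∑ c, k c = 1)
    (A : S → C → Prop) {K : ℝ} (hK : 0 < K) (hA : ∀ s c, A s c → w s c ≤ K * k c)
    (g : S → C → ℝ) (hg : ∀ s c, 0 ≤ g s c) {η : ℝ} (hη : 0 < η) (B : C → ℝ) (M : ℕ) :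
    ∃ cb : Fin M → C,
      ∑ s, μ s * ind (∀ j, ¬ (A s (cb j) ∧ g s (cb j) ≤ η * μ s)) + ∑ j, B (cb j) ≤
        (∑ s, ∑ c, μ s * w s c * ind (¬ A s c)) + η⁻¹ * (∑ s, ∑ c, w s c * g s c) +
          Real.exp (-(M / K)) * ∑ s, μ s + M * ∑ c, k c * B c := by
  by_contra hcon
  simp only [not_exists, not_le] at hcon
  set R := (∑ s, ∑ c, μ s * w s c * ind (¬ A s c)) + η⁻¹ * (∑ s, ∑ c, w s c * g s c) +
          Real.exp (-(M / K)) * ∑ s, μ s + M * ∑ c, k c * B c with hR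
  have hsum1 := sum_prod_codebook k hk1 M
  have hlt : R < ∑ cb : Fin M → C, (∏ j, k (cb j)) *
      (∑ s, μ s * ind (∀ j, ¬ (A s (cb j) ∧ g s (cb j) ≤ η * μ s)) + ∑ j, B (cb j)) := by
    have hR' : R = ∑ cb : Fin M → C, (∏ j, k (cb j)) * R := by
      rw [← Finset.sum_mul, hsum1, one_mul]
    conv_lhs => rw [hR']
    have hnn : ∀ cb : Fin M → C, 0 ≤ ∏ j, k (cb j) := fun cb =>
      Finset.prod_nonneg fun j _ => hk _
    -- Strictness needs one codebook of positive weight, which exists because the weights sum to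
    -- `1`.
    refine Finset.sum_lt_sum (fun cb _ => mul_le_mul_of_nonneg_left (hcon cb).le (hnn cb)) ?_
    by_contra hall
    have h0 : ∀ cb : Fin M → C, ∏ j, k (cb j) = 0 := by
      intro cb
      by_contra hne
      exact hall ⟨cb, Finset.mem_univ _,
        mul_lt_mul_of_pos_left (hcon cb) (lt_of_le_of_ne (hnn cb) (Ne.symm hne))⟩
    simp [h0] at hsum1
  have hle : ∑ cb : Fin M → C, (∏ j, k (cb j)) *
      (∑ s, μ s * ind (∀ j, ¬ (A s (cb j) ∧ g s (cb j) ≤ η * μ s)) + ∑ j, B (cb j)) ≤ R := by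
    simp_rw [mul_add, Finset.sum_add_distrib]
    rw [sum_codebook_sum k hk1 B M, hR]
    gcongr
    have e1 : ∑ cb : Fin M → C, (∏ j, k (cb j)) *
        (∑ s, μ s * ind (∀ j, ¬ (A s (cb j) ∧ g s (cb j) ≤ η * μ s))) =
        ∑ s, μ s * ∑ cb : Fin M → C, (∏ j, k (cb j)) *
          ind (∀ j, ¬ (A s (cb j) ∧ g s (cb j) ≤ η * μ s)) := by
      simp_rw [Finset.mul_sum]
      rw [Finset.sum_comm]
      refine Finset.sum_congr rfl fun s _ => Finset.sum_congr rfl fun cb _ => by ring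
    rw [e1, Finset.mul_sum, Finset.mul_sum, ← Finset.sum_add_distrib, ← Finset.sum_add_distrib]
    refine Finset.sum_le_sum fun s _ => ?_
    have h := codebook_miss_le (w s) k (hw s) (hw1 s) hk hk1
      (fun c => A s c ∧ g s c ≤ η * μ s) hK (fun c hc => hA s c hc.1) M
    refine (mul_le_mul_of_nonneg_left h (hμ s)).trans ?_
    rw [mul_add, mul_comm (μ s) (Real.exp _), Finset.mul_sum, Finset.mul_sum,
      ← Finset.sum_add_distrib]
    gcongr with c _
    -- Markov's inequality: a word that satisfies `A` but is refused for its loss has `μ s < η⁻¹ * g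
    -- s c`.
    by_cases hAc : A s c
    · by_cases hgc : g s c ≤ η * μ s
      · rw [ind_of_not (by simp [hAc, hgc])]
        have := mul_nonneg (inv_nonneg.2 hη.le) (mul_nonneg (hw s c) (hg s c))
        simp [ind_of_not (not_not.2 hAc)]
        linarith
      · rw [ind_of (by simp [hgc]), ind_of_not (not_not.2 hAc)]
        push Not at hgc
        have : μ s ≤ η⁻¹ * g s c := by
          rw [inv_mul_eq_div, le_div_iff₀ hη]; linarith
        have := mul_le_mul_of_nonneg_left this (hw s c)
        linarith
    · rw [ind_of (by simp [hAc]), ind_of hAc]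
      have := mul_nonneg (inv_nonneg.2 hη.le) (mul_nonneg (hw s c) (hg s c))
      linarith
  linarith

end Covering

/-! ### A two-level code -/

section OneShot

variable {Ω 𝓤 𝓥 𝓧 𝓨 𝓩 : Type*} [Fintype Ω] [Fintype 𝓤] [Fintype 𝓥] [Fintype 𝓧] [Fintype 𝓨]

/-- Encoding by search: some index `j` with `p j`, if there is one. -/
lemma exists_search {α : Type*} {M : ℕ} (p : α → Fin M → Prop) :
    ∃ enc : α → Option (Fin M), (∀ a j, enc a = some j → p a j) ∧
      ∀ a, enc a = none → ∀ j, ¬ p a j := by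
  have h : ∀ a, ∃ o : Option (Fin M), (∀ j, o = some j → p a j) ∧ (o = none → ∀ j, ¬ p a j) := by
    intro a
    by_cases h : ∃ j, p a j
    · obtain ⟨j, hj⟩ := h
      exact ⟨some j, by rintro i ⟨⟩; exact hj, by simp⟩
    · push Not at h
      exact ⟨none, by simp, fun _ => h⟩
  choose enc h1 h2 using h
  exact ⟨enc, h1, h2⟩

/-- The code for a fixed codeword `u` of the first level: the sources are restricted to the event
`E` that `u` has been selected. -/
lemma exists_cooperation_code (Y : Ω → 𝓨) (Z : Ω → 𝓩) (p : Ω → ℝ) (hp : ∀ ω, 0 ≤ p ω)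
    (E : Ω → Prop) (w : 𝓨 → 𝓥 → ℝ) (hw : ∀ y v, 0 ≤ w y v) (hw1 : ∀ y, ∑ v, w y v = 1)
    (k : 𝓥 → ℝ) (hk : ∀ v, 0 ≤ k v) (hk1 : ∑ v, k v = 1)
    (A₂ : 𝓥 → 𝓨 → Prop) (A₃ : 𝓥 → 𝓩 → Prop) {K : ℝ} (hK : 0 < K)
    (hA₂ : ∀ v y, A₂ v y → w y v ≤ K * k v) {η : ℝ} (hη : 0 < η) (B : 𝓥 → ℝ) (M : ℕ) :
    ∃ (enc : 𝓨 → Option (Fin M)) (cb : Fin M → 𝓥),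
      (∀ y i, enc y = some i → A₂ (cb i) y) ∧
      ∑ ω, p ω * ind (E ω) * ind (¬ ∃ i, enc (Y ω) = some i ∧ A₃ (cb i) (Z ω)) +
          ∑ i, B (cb i) ≤
        (1 + η⁻¹) * (∑ ω, p ω * ind (E ω) *
          ∑ v, w (Y ω) v * ind (¬ (A₂ v (Y ω) ∧ A₃ v (Z ω)))) +
        (Real.exp (-(M / K)) + η) * (∑ ω, p ω * ind (E ω)) + M * ∑ v, k v * B v := by
  -- `g y v / μ y` is the conditional probability, given `y` and the event `E`, that the final test
  -- `A₃` rejects `v`. The encoder sees only `y`, so it can require this ratio to be at most `η`.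
  set μ : 𝓨 → ℝ := fun y => ∑ ω, ind (Y ω = y) * (p ω * ind (E ω)) with hμ
  set g : 𝓨 → 𝓥 → ℝ :=
    fun y v => ∑ ω, ind (Y ω = y) * (p ω * ind (E ω) * ind (¬ A₃ v (Z ω))) with hg
  have hpE : ∀ ω, 0 ≤ p ω * ind (E ω) := fun ω => mul_nonneg (hp ω) (ind_nonneg _)
  have hμ0 : ∀ y, 0 ≤ μ y := fun y =>
    Finset.sum_nonneg fun ω _ => mul_nonneg (ind_nonneg _) (hpE ω)
  have hg0 : ∀ y v, 0 ≤ g y v := fun y v => Finset.sum_nonneg fun ω _ =>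
    mul_nonneg (ind_nonneg _) (mul_nonneg (hpE ω) (ind_nonneg _))
  have hμsum : ∑ y, μ y = ∑ ω, p ω * ind (E ω) := sum_fiber Y fun _ ω => p ω * ind (E ω)
  obtain ⟨cb, hcb⟩ := exists_codebook μ hμ0 w hw hw1 k hk hk1 (fun y v => A₂ v y) hK
    (fun y v h => hA₂ v y h) g hg0 hη B M
  obtain ⟨enc, henc, henc'⟩ :=
    exists_search fun y (i : Fin M) => A₂ (cb i) y ∧ g y (cb i) ≤ η * μ y
  refine ⟨enc, cb, fun y i h => (henc y i h).1, ?_⟩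
  set T := ∑ ω, p ω * ind (E ω) * ∑ v, w (Y ω) v * ind (¬ (A₂ v (Y ω) ∧ A₃ v (Z ω))) with hT
  have hT1 : ∑ y, ∑ v, μ y * w y v * ind (¬ A₂ v y) ≤ T := by
    have e : ∑ y, ∑ v, μ y * w y v * ind (¬ A₂ v y) =
        ∑ ω, p ω * ind (E ω) * ∑ v, w (Y ω) v * ind (¬ A₂ v (Y ω)) := by
      rw [← sum_fiber Y fun y ω => p ω * ind (E ω) * ∑ v, w y v * ind (¬ A₂ v y)]
      refine Finset.sum_congr rfl fun y _ => ?_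
      simp_rw [hμ, mul_assoc, ← Finset.mul_sum, Finset.sum_mul, mul_assoc]
    rw [e, hT]
    gcongr with ω _ v _
    · exact hpE ω
    · exact hw _ _
    · exact ind_mono (by tauto)
  have hT2 : ∑ y, ∑ v, w y v * g y v ≤ T := by
    have e : ∑ y, ∑ v, w y v * g y v =
        ∑ ω, p ω * ind (E ω) * ∑ v, w (Y ω) v * ind (¬ A₃ v (Z ω)) := by
      rw [← sum_fiber Y fun y ω => p ω * ind (E ω) * ∑ v, w y v * ind (¬ A₃ v (Z ω))]
      refine Finset.sum_congr rfl fun y _ => ?_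
      simp_rw [hg, Finset.mul_sum]
      rw [Finset.sum_comm]
      refine Finset.sum_congr rfl fun ω _ => Finset.sum_congr rfl fun v _ => by ring
    rw [e, hT]
    gcongr with ω _ v _
    · exact hpE ω
    · exact hw _ _
    · exact ind_mono (by tauto)
  have hα : ∑ ω, p ω * ind (E ω) * ind (¬ ∃ i, enc (Y ω) = some i ∧ A₃ (cb i) (Z ω)) ≤
      ∑ y, μ y * ind (∀ i, ¬ (A₂ (cb i) y ∧ g y (cb i) ≤ η * μ y)) +
        η * ∑ ω, p ω * ind (E ω) := by
    have h1 : ∀ ω, p ω * ind (E ω) * ind (¬ ∃ i, enc (Y ω) = some i ∧ A₃ (cb i) (Z ω)) ≤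
        p ω * ind (E ω) * ind (enc (Y ω) = none) +
          ∑ i, ind (enc (Y ω) = some i) * (p ω * ind (E ω) * ind (¬ A₃ (cb i) (Z ω))) := by
      intro ω
      rcases h : enc (Y ω) with _ | i
      · simp [ind]
      · have := sum_ind_eq i fun j => p ω * ind (E ω) * ind (¬ A₃ (cb j) (Z ω))
        simp only [Option.some.injEq, this, reduceCtorEq, exists_eq_left']
        rw [ind_of_not (p := False) (by simp)]
        simp
    refine (Finset.sum_le_sum fun ω _ => h1 ω).trans ?_
    rw [Finset.sum_add_distrib]
    refine add_le_add ?_ ?_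
    · rw [← sum_fiber Y fun y ω => p ω * ind (E ω) * ind (enc y = none)]
      refine Finset.sum_le_sum fun y _ => ?_
      simp_rw [← mul_assoc, ← Finset.sum_mul]
      simp_rw [mul_assoc]
      exact mul_le_mul_of_nonneg_left (ind_mono fun h => henc' y h) (hμ0 y)
    · rw [← sum_fiber Y fun y ω =>
        ∑ i, ind (enc y = some i) * (p ω * ind (E ω) * ind (¬ A₃ (cb i) (Z ω))), ← hμsum,
        Finset.mul_sum]
      refine Finset.sum_le_sum fun y _ => ?_
      have e : ∑ ω, ind (Y ω = y) *
          ∑ i, ind (enc y = some i) * (p ω * ind (E ω) * ind (¬ A₃ (cb i) (Z ω))) =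
          ∑ i, ind (enc y = some i) * g y (cb i) := by
        simp_rw [hg, Finset.mul_sum]
        rw [Finset.sum_comm]
        refine Finset.sum_congr rfl fun i _ => Finset.sum_congr rfl fun ω _ => by ring
      rw [e]
      -- A selected word has passed the threshold, so rejection by `A₃` after selection costs at
      -- most the fraction `η` of the mass at `y`.
      calc ∑ i, ind (enc y = some i) * g y (cb i)
          ≤ ∑ i, ind (enc y = some i) * (η * μ y) := by
            refine Finset.sum_le_sum fun i _ => ?_
            by_cases h : enc y = some i
            · rw [ind_of h]; linarith [(henc y i h).2]
            · rw [ind_of_not h]; simp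
        _ = (∑ i, ind (enc y = some i)) * (η * μ y) := by rw [Finset.sum_mul]
        _ ≤ η * μ y := mul_le_of_le_one_left (mul_nonneg hη.le (hμ0 y)) (sum_ind_some_le_one _)
  have hT2' := mul_le_mul_of_nonneg_left hT2 (inv_nonneg.2 hη.le)
  rw [hμsum] at hcb
  linarith

/-- The loss of a first-level word `u` at `x` combines two masses: under `p`, that the second level
drawn from its test channel is atypical; under `pbar`, that Detector 1's test `A₄` rejects `u`. The
price of `u` is its weighted contribution to both type II union bounds, the second averaged over the
words `v`. Once the first level is fixed, each `u` receives its own second-level code. -/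
theorem exists_code (X : Ω → 𝓧) (Y : Ω → 𝓨) (Z : Ω → 𝓩) (p pbar : Ω → ℝ)
    (hp : ∀ ω, 0 ≤ p ω) (hpbar : ∀ ω, 0 ≤ pbar ω) (hp1 : ∑ ω, p ω = 1)
    (hX : ∀ x, ∑ ω, ind (X ω = x) * p ω = ∑ ω, ind (X ω = x) * pbar ω)
    (w₁ : 𝓧 → 𝓤 → ℝ) (hw₁ : ∀ x u, 0 ≤ w₁ x u) (hw₁1 : ∀ x, ∑ u, w₁ x u = 1)
    (w₂ : 𝓨 → 𝓤 → 𝓥 → ℝ) (hw₂ : ∀ y u v, 0 ≤ w₂ y u v) (hw₂1 : ∀ y u, ∑ v, w₂ y u v = 1)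
    (r : 𝓤 → ℝ) (hr : ∀ u, 0 ≤ r u) (hr1 : ∑ u, r u = 1)
    (k : 𝓤 → 𝓥 → ℝ) (hk : ∀ u v, 0 ≤ k u v) (hk1 : ∀ u, ∑ v, k u v = 1)
    (A₁ : 𝓤 → 𝓧 → Prop) (A₂ : 𝓤 → 𝓥 → 𝓨 → Prop) (A₃ : 𝓤 → 𝓥 → 𝓩 → Prop) (A₄ : 𝓤 → 𝓨 → Prop)
    {K₁ K₂ : ℝ} (hK₁ : 0 < K₁) (hK₂ : 0 < K₂)
    (hA₁ : ∀ u x, A₁ u x → w₁ x u ≤ K₁ * r u)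
    (hA₂ : ∀ u v y, A₂ u v y → w₂ y u v ≤ K₂ * k u v)
    {η : ℝ} (hη : 0 < η) {l₁ l₂ : ℝ} (hl₁ : 0 ≤ l₁) (hl₂ : 0 ≤ l₂) (M₁ M₂ : ℕ) {Δ : ℝ}
    (hΔ : (∑ ω, p ω * ∑ u, w₁ (X ω) u * ind (¬ A₁ u (X ω))) +
        (η ^ 2)⁻¹ * ((∑ ω, p ω * ∑ u, w₁ (X ω) u *
            ∑ v, w₂ (Y ω) u v * ind (¬ (A₂ u v (Y ω) ∧ A₃ u v (Z ω)))) +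
          ∑ ω, pbar ω * ∑ u, w₁ (X ω) u * ind (¬ A₄ u (Y ω))) +
        Real.exp (-(M₁ / K₁)) + Real.exp (-(M₂ / K₂)) + 2 * η + 2 * η ^ 2 +
        l₁ * (M₁ * ∑ u, r u * ∑ ω, p ω * ind (A₁ u (X ω) ∧ A₄ u (Y ω))) +
        l₂ * (M₁ * M₂ * ∑ u, r u * ∑ v, k u v *
          ∑ ω, pbar ω * ind (A₁ u (X ω) ∧ A₂ u v (Y ω) ∧ A₃ u v (Z ω))) ≤ Δ) :
    ∃ (enc₁ : 𝓧 → Option (Fin M₁)) (enc₂ : Fin M₁ → 𝓨 → Option (Fin M₂))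
      (C₁ : Fin M₁ → 𝓤) (C₂ : Fin M₁ → Fin M₂ → 𝓥),
      ∑ ω, pbar ω * ind (¬ ∃ j, enc₁ (X ω) = some j ∧ A₄ (C₁ j) (Y ω)) ≤ Δ ∧
      ∑ ω, p ω * ind (¬ ∃ j, enc₁ (X ω) = some j ∧
        ∃ i, enc₂ j (Y ω) = some i ∧ A₃ (C₁ j) (C₂ j i) (Z ω)) ≤ Δ ∧
      l₁ * ∑ ω, p ω * ind (∃ j, enc₁ (X ω) = some j ∧ A₄ (C₁ j) (Y ω)) ≤ Δ ∧
      l₂ * ∑ ω, pbar ω * ind (∃ j, enc₁ (X ω) = some j ∧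
        ∃ i, enc₂ j (Y ω) = some i ∧ A₃ (C₁ j) (C₂ j i) (Z ω)) ≤ Δ := by
  set b₁ : 𝓤 → ℝ := fun u => ∑ ω, p ω * ind (A₁ u (X ω) ∧ A₄ u (Y ω)) with hb₁
  set b₂ : 𝓤 → 𝓥 → ℝ := fun u v =>
    ∑ ω, pbar ω * ind (A₁ u (X ω) ∧ A₂ u v (Y ω) ∧ A₃ u v (Z ω)) with hb₂
  set μ : 𝓧 → ℝ := fun x => ∑ ω, ind (X ω = x) * p ω with hμ
  set a : 𝓤 → Ω → ℝ := fun u ω =>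
    ∑ v, w₂ (Y ω) u v * ind (¬ (A₂ u v (Y ω) ∧ A₃ u v (Z ω))) with ha
  set gp : 𝓧 → 𝓤 → ℝ := fun x u => ∑ ω, ind (X ω = x) * (p ω * a u ω) with hgp
  set gq : 𝓧 → 𝓤 → ℝ := fun x u =>
    ∑ ω, ind (X ω = x) * (pbar ω * ind (¬ A₄ u (Y ω))) with hgq
  have ha0 : ∀ u ω, 0 ≤ a u ω := fun u ω =>
    Finset.sum_nonneg fun v _ => mul_nonneg (hw₂ _ _ _) (ind_nonneg _)
  have hμ0 : ∀ x, 0 ≤ μ x := fun x =>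
    Finset.sum_nonneg fun ω _ => mul_nonneg (ind_nonneg _) (hp ω)
  have hgp0 : ∀ x u, 0 ≤ gp x u := fun x u =>
    Finset.sum_nonneg fun ω _ => mul_nonneg (ind_nonneg _) (mul_nonneg (hp ω) (ha0 u ω))
  have hgq0 : ∀ x u, 0 ≤ gq x u := fun x u =>
    Finset.sum_nonneg fun ω _ => mul_nonneg (ind_nonneg _) (mul_nonneg (hpbar ω) (ind_nonneg _))
  have hμsum : ∑ x, μ x = 1 := by rw [← hp1]; exact sum_fiber X fun _ ω => p ω
  have hfib : ∀ G : 𝓧 → ℝ, ∑ x, μ x * G x = ∑ ω, p ω * G (X ω) := by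
    intro G
    rw [← sum_fiber X fun x ω => p ω * G x]
    refine Finset.sum_congr rfl fun x _ => ?_
    simp_rw [hμ, Finset.sum_mul, mul_assoc]
  -- Equality of the two marginals of `X` enters here: the same `μ` computes expectations of
  -- functions of `X` under `pbar`.
  have hfib' : ∀ G : 𝓧 → ℝ, ∑ x, μ x * G x = ∑ ω, pbar ω * G (X ω) := by
    intro G
    rw [← sum_fiber X fun x ω => pbar ω * G x]
    refine Finset.sum_congr rfl fun x _ => ?_
    simp_rw [← mul_assoc, ← Finset.sum_mul, hμ, hX]
  have hη2 : 0 < η ^ 2 := by positivity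
  -- The threshold is `η ^ 2` because the second level multiplies this loss by `1 + η⁻¹`, which
  -- leaves `η ^ 2 + η`.
  obtain ⟨C₁, hC₁⟩ := exists_codebook μ hμ0 w₁ hw₁ hw₁1 r hr hr1 (fun x u => A₁ u x) hK₁
    (fun x u h => hA₁ u x h) (fun x u => gp x u + gq x u)
    (fun x u => add_nonneg (hgp0 x u) (hgq0 x u)) hη2
    (fun u => l₁ * b₁ u + l₂ * (M₂ * ∑ v, k u v * b₂ u v)) M₁
  obtain ⟨enc₁, henc, henc'⟩ := exists_search fun x (j : Fin M₁) =>
    A₁ (C₁ j) x ∧ gp x (C₁ j) + gq x (C₁ j) ≤ η ^ 2 * μ x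
  have hlev2 := fun j : Fin M₁ => exists_cooperation_code Y Z p hp
    (fun ω => enc₁ (X ω) = some j) (fun y v => w₂ y (C₁ j) v) (fun y v => hw₂ y _ v)
    (fun y => hw₂1 y _) (k (C₁ j)) (hk _) (hk1 _) (A₂ (C₁ j)) (A₃ (C₁ j)) hK₂
    (fun v y h => hA₂ _ v y h) hη (fun v => l₂ * b₂ (C₁ j) v) M₂
  choose enc₂ C₂ henc₂ hC₂ using hlev2
  refine ⟨enc₁, enc₂, C₁, C₂, ?_⟩
  set F := ∑ x, μ x * ind (∀ j, ¬ (A₁ (C₁ j) x ∧ gp x (C₁ j) + gq x (C₁ j) ≤ η ^ 2 * μ x))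
    with hF
  have hfail : ∑ x, μ x * ind (enc₁ x = none) ≤ F :=
    Finset.sum_le_sum fun x _ => mul_le_mul_of_nonneg_left (ind_mono (henc' x)) (hμ0 x)
  have hcost : ∀ G : 𝓧 → 𝓤 → ℝ, (∀ x u, G x u ≤ gp x u + gq x u) →
      ∑ j, ∑ x, ind (enc₁ x = some j) * G x (C₁ j) ≤ η ^ 2 := by
    intro G hG
    rw [Finset.sum_comm]
    calc ∑ x, ∑ j, ind (enc₁ x = some j) * G x (C₁ j)
        ≤ ∑ x, ∑ j, ind (enc₁ x = some j) * (η ^ 2 * μ x) := by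
          refine Finset.sum_le_sum fun x _ => Finset.sum_le_sum fun j _ => ?_
          by_cases h : enc₁ x = some j
          · rw [ind_of h]; linarith [(henc x j h).2, hG x (C₁ j)]
          · rw [ind_of_not h]; simp
      _ = ∑ x, (∑ j, ind (enc₁ x = some j)) * (η ^ 2 * μ x) := by
          simp_rw [Finset.sum_mul]
      _ ≤ ∑ x, η ^ 2 * μ x := Finset.sum_le_sum fun x _ =>
          mul_le_of_le_one_left (mul_nonneg hη2.le (hμ0 x)) (sum_ind_some_le_one _)
      _ = η ^ 2 := by rw [← Finset.mul_sum, hμsum, mul_one]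
  -- the error probabilities of the decision against the alternative
  have hα₁ : ∑ ω, pbar ω * ind (¬ ∃ j, enc₁ (X ω) = some j ∧ A₄ (C₁ j) (Y ω)) ≤ F + η ^ 2 := by
    have h1 : ∀ ω, pbar ω * ind (¬ ∃ j, enc₁ (X ω) = some j ∧ A₄ (C₁ j) (Y ω)) ≤
        pbar ω * ind (enc₁ (X ω) = none) +
          ∑ j, ind (enc₁ (X ω) = some j) * (pbar ω * ind (¬ A₄ (C₁ j) (Y ω))) := by
      intro ω
      rcases h : enc₁ (X ω) with _ | i
      · simp [ind]
      · have := sum_ind_eq i fun j => pbar ω * ind (¬ A₄ (C₁ j) (Y ω))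
        simp only [Option.some.injEq, this, reduceCtorEq, exists_eq_left']
        rw [ind_of_not (p := False) (by simp)]
        simp
    refine (Finset.sum_le_sum fun ω _ => h1 ω).trans ?_
    rw [Finset.sum_add_distrib, ← hfib' fun x => ind (enc₁ x = none)]
    refine add_le_add hfail ?_
    rw [Finset.sum_comm]
    refine le_trans (le_of_eq ?_) (hcost gq fun x u => le_add_of_nonneg_left (hgp0 x u))
    refine Finset.sum_congr rfl fun j _ => ?_
    rw [← sum_fiber X fun x ω => ind (enc₁ x = some j) * (pbar ω * ind (¬ A₄ (C₁ j) (Y ω)))]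
    refine Finset.sum_congr rfl fun x _ => ?_
    simp_rw [hgq, Finset.mul_sum]
    exact Finset.sum_congr rfl fun ω _ => by ring
  have hα₂ : ∑ ω, p ω * ind (¬ ∃ j, enc₁ (X ω) = some j ∧
        ∃ i, enc₂ j (Y ω) = some i ∧ A₃ (C₁ j) (C₂ j i) (Z ω)) ≤
      F + ∑ j, ∑ ω, p ω * ind (enc₁ (X ω) = some j) *
        ind (¬ ∃ i, enc₂ j (Y ω) = some i ∧ A₃ (C₁ j) (C₂ j i) (Z ω)) := by
    have h1 : ∀ ω, p ω * ind (¬ ∃ j, enc₁ (X ω) = some j ∧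
        ∃ i, enc₂ j (Y ω) = some i ∧ A₃ (C₁ j) (C₂ j i) (Z ω)) ≤
        p ω * ind (enc₁ (X ω) = none) + ∑ j, p ω * ind (enc₁ (X ω) = some j) *
          ind (¬ ∃ i, enc₂ j (Y ω) = some i ∧ A₃ (C₁ j) (C₂ j i) (Z ω)) := by
      intro ω
      rcases h : enc₁ (X ω) with _ | j
      · simp [ind]
      · refine le_add_of_nonneg_of_le (mul_nonneg (hp ω) (ind_nonneg _)) ?_
        refine le_trans ?_ (Finset.single_le_sum
          (fun i _ => mul_nonneg (mul_nonneg (hp ω) (ind_nonneg _)) (ind_nonneg _))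
          (Finset.mem_univ j))
        rw [ind_of (p := some j = some j) rfl, mul_one]
        exact mul_le_mul_of_nonneg_left
          (ind_mono fun h1 ⟨i, h2⟩ => h1 ⟨j, rfl, i, h2⟩) (hp ω)
    refine (Finset.sum_le_sum fun ω _ => h1 ω).trans ?_
    rw [Finset.sum_add_distrib, ← hfib fun x => ind (enc₁ x = none), Finset.sum_comm]
    exact add_le_add hfail le_rfl
  have hβ₁ : ∑ ω, p ω * ind (∃ j, enc₁ (X ω) = some j ∧ A₄ (C₁ j) (Y ω)) ≤
      ∑ j, b₁ (C₁ j) := by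
    rw [hb₁, Finset.sum_comm]
    refine Finset.sum_le_sum fun ω _ => ?_
    rw [← Finset.mul_sum]
    refine mul_le_mul_of_nonneg_left ((ind_exists_le _).trans ?_) (hp ω)
    exact Finset.sum_le_sum fun j _ => ind_mono fun h => ⟨(henc _ _ h.1).1, h.2⟩
  have hβ₂ : ∑ ω, pbar ω * ind (∃ j, enc₁ (X ω) = some j ∧
        ∃ i, enc₂ j (Y ω) = some i ∧ A₃ (C₁ j) (C₂ j i) (Z ω)) ≤
      ∑ j, ∑ i, b₂ (C₁ j) (C₂ j i) := by
    refine le_trans ?_ (Finset.sum_comm.trans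
      (Finset.sum_congr rfl fun j _ => Finset.sum_comm)).le
    refine Finset.sum_le_sum fun ω _ => ?_
    simp_rw [← Finset.mul_sum]
    refine mul_le_mul_of_nonneg_left ((ind_exists_le _).trans ?_) (hpbar ω)
    refine Finset.sum_le_sum fun j _ => le_trans (ind_mono ?_) (ind_exists_le _)
    rintro ⟨h1, i, h2, h3⟩
    exact ⟨i, (henc _ _ h1).1, henc₂ _ _ _ h2, h3⟩
  -- the sum over the cells of the second level
  have hsum2 := Finset.sum_le_sum fun j (_ : j ∈ Finset.univ) => hC₂ j
  simp only [Finset.sum_add_distrib, ← Finset.mul_sum] at hsum2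
  have hcell : ∑ j, ∑ ω, p ω * ind (enc₁ (X ω) = some j) ≤ 1 := by
    rw [Finset.sum_comm, ← hp1]
    refine Finset.sum_le_sum fun ω _ => ?_
    rw [← Finset.mul_sum]
    exact mul_le_of_le_one_right (hp ω) (sum_ind_some_le_one _)
  have hT : ∑ j, ∑ ω, p ω * ind (enc₁ (X ω) = some j) * a (C₁ j) ω ≤ η ^ 2 := by
    refine le_trans (le_of_eq ?_) (hcost gp fun x u => le_add_of_nonneg_right (hgq0 x u))
    refine Finset.sum_congr rfl fun j _ => ?_
    rw [← sum_fiber X fun x ω => p ω * ind (enc₁ x = some j) * a (C₁ j) ω]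
    refine Finset.sum_congr rfl fun x _ => ?_
    simp_rw [hgp, Finset.mul_sum]
    exact Finset.sum_congr rfl fun ω _ => by ring
  have hT' : (1 + η⁻¹) * (∑ j, ∑ ω, p ω * ind (enc₁ (X ω) = some j) * a (C₁ j) ω) ≤
      η ^ 2 + η := by
    refine (mul_le_mul_of_nonneg_left hT (by positivity)).trans_eq ?_
    field_simp
  have hcell' : (Real.exp (-(M₂ / K₂)) + η) *
      (∑ j, ∑ ω, p ω * ind (enc₁ (X ω) = some j)) ≤ Real.exp (-(M₂ / K₂)) + η :=
    mul_le_of_le_one_right (by positivity) hcell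
  -- the average over the codebooks of the first level
  have e1 : ∑ x, ∑ u, μ x * w₁ x u * ind (¬ A₁ u x) =
      ∑ ω, p ω * ∑ u, w₁ (X ω) u * ind (¬ A₁ u (X ω)) := by
    rw [← hfib fun x => ∑ u, w₁ x u * ind (¬ A₁ u x)]
    simp_rw [Finset.mul_sum, mul_assoc]
  have e2 : ∑ x, ∑ u, w₁ x u * (gp x u + gq x u) =
      (∑ ω, p ω * ∑ u, w₁ (X ω) u * a u ω) +
        ∑ ω, pbar ω * ∑ u, w₁ (X ω) u * ind (¬ A₄ u (Y ω)) := by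
    simp_rw [mul_add, Finset.sum_add_distrib]
    congr 1
    · rw [← sum_fiber X fun x ω => p ω * ∑ u, w₁ x u * a u ω]
      refine Finset.sum_congr rfl fun x _ => ?_
      simp_rw [hgp, Finset.mul_sum]
      rw [Finset.sum_comm]
      exact Finset.sum_congr rfl fun ω _ => Finset.sum_congr rfl fun u _ => by ring
    · rw [← sum_fiber X fun x ω => pbar ω * ∑ u, w₁ x u * ind (¬ A₄ u (Y ω))]
      refine Finset.sum_congr rfl fun x _ => ?_
      simp_rw [hgq, Finset.mul_sum]
      rw [Finset.sum_comm]
      exact Finset.sum_congr rfl fun ω _ => Finset.sum_congr rfl fun u _ => by ring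
  have e3 : (M₁ : ℝ) * ∑ u, r u * (l₁ * b₁ u + l₂ * (M₂ * ∑ v, k u v * b₂ u v)) =
      l₁ * (M₁ * ∑ u, r u * b₁ u) + l₂ * (M₁ * M₂ * ∑ u, r u * ∑ v, k u v * b₂ u v) := by
    simp_rw [mul_add, Finset.sum_add_distrib, mul_add]
    congr 1
    · simp_rw [Finset.mul_sum]
      exact Finset.sum_congr rfl fun u _ => by ring
    · rw [Finset.mul_sum, Finset.mul_sum, Finset.mul_sum]
      exact Finset.sum_congr rfl fun u _ => by ring
  have e4 : ∑ j, (l₁ * b₁ (C₁ j) + l₂ * (M₂ * ∑ v, k (C₁ j) v * b₂ (C₁ j) v)) =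
      l₁ * ∑ j, b₁ (C₁ j) + M₂ * ∑ j, ∑ v, k (C₁ j) v * (l₂ * b₂ (C₁ j) v) := by
    rw [Finset.sum_add_distrib, Finset.mul_sum, Finset.mul_sum]
    congr 1
    refine Finset.sum_congr rfl fun j _ => ?_
    simp_rw [Finset.mul_sum]
    exact Finset.sum_congr rfl fun v _ => by ring
  rw [e1, e2, e3, e4, hμsum, mul_one] at hC₁
  have hF0 : 0 ≤ F := Finset.sum_nonneg fun x _ => mul_nonneg (hμ0 x) (ind_nonneg _)
  have hb₁0 : 0 ≤ l₁ * ∑ j, b₁ (C₁ j) := mul_nonneg hl₁ <| Finset.sum_nonneg fun j _ =>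
    Finset.sum_nonneg fun ω _ => mul_nonneg (hp ω) (ind_nonneg _)
  have hb₂0 : 0 ≤ l₂ * ∑ j, ∑ i, b₂ (C₁ j) (C₂ j i) := mul_nonneg hl₂ <|
    Finset.sum_nonneg fun j _ => Finset.sum_nonneg fun i _ =>
      Finset.sum_nonneg fun ω _ => mul_nonneg (hpbar ω) (ind_nonneg _)
  have hα0 : 0 ≤ ∑ j, ∑ ω, p ω * ind (enc₁ (X ω) = some j) *
        ind (¬ ∃ i, enc₂ j (Y ω) = some i ∧ A₃ (C₁ j) (C₂ j i) (Z ω)) :=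
    Finset.sum_nonneg fun j _ => Finset.sum_nonneg fun ω _ =>
      mul_nonneg (mul_nonneg (hp ω) (ind_nonneg _)) (ind_nonneg _)
  have hβ₁' := mul_le_mul_of_nonneg_left hβ₁ hl₁
  have hβ₂' := mul_le_mul_of_nonneg_left hβ₂ hl₂
  -- Adding `hC₁` and `hsum2` cancels the averaged second-level price. The budget `2 * η + 2 * η ^
  -- 2` is `η ^ 2` from `hα₁`, `η ^ 2 + η` from `hT'` and `η` from `hcell'`.
  refine ⟨?_, ?_, ?_, ?_⟩ <;> linarith

end OneShot

/-! ### Independent and identically distributed sequences -/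

section Iid

variable {α β : Type*} [Fintype α] [Fintype β]

lemma sum_fun_succ {n : ℕ} (F : (Fin (n + 1) → α) → ℝ) :
    ∑ s, F s = ∑ a, ∑ s : Fin n → α, F (Fin.cons a s) := by
  rw [← Fintype.sum_prod_type']
  exact ((Fin.consEquiv fun _ => α).sum_comp F).symm

lemma sum_fun_prod {n : ℕ} (F : (Fin n → α × β) → ℝ) :
    ∑ s, F s = ∑ a : Fin n → α, ∑ b : Fin n → β, F fun t => (a t, b t) := by
  rw [← Fintype.sum_prod_type']
  exact ((Equiv.arrowProdEquivProdArrow (Fin n) (fun _ => α) (fun _ => β)).symm.sum_comp F).symm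

lemma sum_iid {p : α → ℝ} (hp1 : ∑ a, p a = 1) (n : ℕ) :
    ∑ s : Fin n → α, ∏ t, p (s t) = 1 := by
  rw [← Fintype.sum_pow, hp1, one_pow]

lemma sum_iid_mean {p : α → ℝ} (hp1 : ∑ a, p a = 1) {g : α → ℝ} (hg : ∑ a, p a * g a = 0)
    (n : ℕ) : ∑ s : Fin n → α, (∏ t, p (s t)) * ∑ t, g (s t) = 0 := by
  rw [sum_codebook_sum p hp1 g n, hg, mul_zero]

/-- Induction on `n`: when the first letter is split off, the cross term vanishes because `g` is
centred. -/
lemma sum_iid_sq {p : α → ℝ} (hp1 : ∑ a, p a = 1) {g : α → ℝ} (hg : ∑ a, p a * g a = 0)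
    (n : ℕ) :
    ∑ s : Fin n → α, (∏ t, p (s t)) * (∑ t, g (s t)) ^ 2 = n * ∑ a, p a * g a ^ 2 := by
  induction n with
  | zero => simp
  | succ n ih =>
    rw [sum_fun_succ]
    have h1 : ∀ a, ∑ s : Fin n → α, (∏ t, p ((Fin.cons a s : Fin (n + 1) → α) t)) *
        (∑ t, g ((Fin.cons a s : Fin (n + 1) → α) t)) ^ 2 =
        p a * g a ^ 2 + p a * (n * ∑ a, p a * g a ^ 2) := by
      intro a
      have h2 : ∀ s : Fin n → α, (∏ t, p ((Fin.cons a s : Fin (n + 1) → α) t)) *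
          (∑ t, g ((Fin.cons a s : Fin (n + 1) → α) t)) ^ 2 =
          p a * g a ^ 2 * (∏ t, p (s t)) + 2 * p a * g a * ((∏ t, p (s t)) * ∑ t, g (s t)) +
            p a * ((∏ t, p (s t)) * (∑ t, g (s t)) ^ 2) := by
        intro s
        rw [Fin.prod_univ_succ, Fin.sum_univ_succ]
        simp only [Fin.cons_zero, Fin.cons_succ]
        ring
      simp_rw [h2, Finset.sum_add_distrib, ← Finset.mul_sum]
      rw [ih, sum_iid_mean hp1 hg, sum_iid hp1]
      ring
    simp_rw [h1, Finset.sum_add_distrib, ← Finset.sum_mul, hp1]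
    push_cast
    ring

/-- The events `E n` have probabilities that tend to `1` under the i.i.d. law `p`. -/
def HighProb (p : α → ℝ) (E : ∀ n, (Fin n → α) → Prop) : Prop :=
  Tendsto (fun n => ∑ s : Fin n → α, (∏ t, p (s t)) * ind (¬ E n s)) atTop (𝓝 0)

/-- Chebyshev's inequality with the variance from `sum_iid_sq`. -/
lemma highProb_mean {p : α → ℝ} (hp : ∀ a, 0 ≤ p a) (hp1 : ∑ a, p a = 1) (f : α → ℝ) {ε : ℝ}
    (hε : 0 < ε) :
    HighProb p fun n s => |∑ t, f (s t) - n * ∑ a, p a * f a| ≤ n * ε := by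
  obtain ⟨m, hm⟩ : ∃ m, m = ∑ a, p a * f a := ⟨_, rfl⟩
  rw [← hm]
  have hg : ∑ a, p a * (f a - m) = 0 := by
    simp_rw [mul_sub, Finset.sum_sub_distrib, ← Finset.sum_mul, hp1, one_mul, ← hm, sub_self]
  set v := ∑ a, p a * (f a - m) ^ 2 with hv
  have hlim : Tendsto (fun n : ℕ => v / ε ^ 2 / (n : ℝ)) atTop (𝓝 0) :=
    tendsto_const_div_atTop_nhds_zero_nat _
  refine tendsto_of_tendsto_of_tendsto_of_le_of_le' tendsto_const_nhds hlim
    (Eventually.of_forall fun n => Finset.sum_nonneg fun s _ =>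
      mul_nonneg (Finset.prod_nonneg fun t _ => hp _) (ind_nonneg _)) ?_
  filter_upwards [eventually_gt_atTop 0] with n hn
  have hn' : (0 : ℝ) < n := by exact_mod_cast hn
  have hpos : 0 < (n * ε) ^ 2 := by positivity
  have e : v / ε ^ 2 / (n : ℝ) = ((n * ε) ^ 2)⁻¹ *
      ∑ s : Fin n → α, (∏ t, p (s t)) * (∑ t, (f (s t) - m)) ^ 2 := by
    rw [sum_iid_sq hp1 hg n]
    field_simp
    rw [hv]
  rw [e, Finset.mul_sum]
  refine Finset.sum_le_sum fun s _ => ?_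
  have hs : 0 ≤ ∏ t, p (s t) := Finset.prod_nonneg fun t _ => hp _
  rw [mul_left_comm]
  refine mul_le_mul_of_nonneg_left ?_ hs
  by_cases h : |∑ t, f (s t) - n * m| ≤ n * ε
  · rw [ind_of_not (not_not.2 h)]
    positivity
  · rw [ind_of h, inv_mul_eq_div, le_div_iff₀ hpos, one_mul]
    push Not at h
    have e2 : ∑ t, (f (s t) - m) = ∑ t, f (s t) - n * m := by simp [Finset.sum_sub_distrib]
    rw [e2, ← sq_abs (∑ t, f (s t) - n * m)]
    exact pow_le_pow_left₀ (by positivity) h.le 2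

lemma HighProb.mono {p : α → ℝ} (hp : ∀ a, 0 ≤ p a) {E F : ∀ n, (Fin n → α) → Prop}
    (hE : HighProb p E) (h : ∀ n s, 0 < ∏ t, p (s t) → E n s → F n s) : HighProb p F := by
  refine tendsto_of_tendsto_of_tendsto_of_le_of_le tendsto_const_nhds hE
    (fun n => Finset.sum_nonneg fun s _ =>
      mul_nonneg (Finset.prod_nonneg fun t _ => hp _) (ind_nonneg _)) ?_
  intro n
  refine Finset.sum_le_sum fun s _ => ?_
  have hs : 0 ≤ ∏ t, p (s t) := Finset.prod_nonneg fun t _ => hp _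
  rcases hs.eq_or_lt with h0 | h0
  · rw [← h0, zero_mul, zero_mul]
  · exact mul_le_mul_of_nonneg_left (ind_mono fun hF hE => hF (h n s h0 hE)) hs

lemma HighProb.and {p : α → ℝ} (hp : ∀ a, 0 ≤ p a) {E F : ∀ n, (Fin n → α) → Prop}
    (hE : HighProb p E) (hF : HighProb p F) : HighProb p fun n s => E n s ∧ F n s := by
  have h := Tendsto.add hE hF
  rw [add_zero] at h
  refine tendsto_of_tendsto_of_tendsto_of_le_of_le tendsto_const_nhds h
    (fun n => Finset.sum_nonneg fun s _ =>
      mul_nonneg (Finset.prod_nonneg fun t _ => hp _) (ind_nonneg _)) ?_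
  intro n
  dsimp only
  rw [← Finset.sum_add_distrib]
  refine Finset.sum_le_sum fun s _ => ?_
  rw [← mul_add]
  exact mul_le_mul_of_nonneg_left (ind_le_add fun h => by tauto)
    (Finset.prod_nonneg fun t _ => hp _)

lemma HighProb.forall {ι : Type*} [Fintype ι] {p : α → ℝ} (hp : ∀ a, 0 ≤ p a)
    {E : ι → ∀ n, (Fin n → α) → Prop} (hE : ∀ i, HighProb p (E i)) :
    HighProb p fun n s => ∀ i, E i n s := by
  have h := tendsto_finsetSum Finset.univ fun i (_ : i ∈ Finset.univ) => hE i
  rw [Finset.sum_const_zero] at h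
  refine tendsto_of_tendsto_of_tendsto_of_le_of_le tendsto_const_nhds h
    (fun n => Finset.sum_nonneg fun s _ =>
      mul_nonneg (Finset.prod_nonneg fun t _ => hp _) (ind_nonneg _)) ?_
  intro n
  dsimp only
  rw [Finset.sum_comm]
  refine Finset.sum_le_sum fun s _ => ?_
  rw [← Finset.mul_sum]
  refine mul_le_mul_of_nonneg_left (le_trans (ind_mono ?_) (ind_exists_le _))
    (Finset.prod_nonneg fun t _ => hp _)
  intro h
  push Not at h
  exact h

/-! ### Types -/

/-- The number of occurrences of `a` in `s`. -/
noncomputable def count {n : ℕ} (s : Fin n → α) (a : α) : ℝ := ∑ t, ind (s t = a)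

/-- The empirical pmf of `s`. -/
noncomputable def emp {n : ℕ} (s : Fin n → α) (a : α) : ℝ := count s a / n

/-- The relative frequencies in `s` differ from `q` by at most `δ`. -/
def Near {n : ℕ} (δ : ℝ) (q : α → ℝ) (s : Fin n → α) : Prop :=
  ∀ a, |count s a - n * q a| ≤ n * δ

/-- The image of a real-valued weight function. -/
noncomputable def push (π : α → β) (T : α → ℝ) (b : β) : ℝ := ∑ a, T a * ind (π a = b)

/-- Divergence of two real-valued weight functions. -/
noncomputable def div (T q : α → ℝ) : ℝ := ∑ a, T a * Real.log (T a / q a)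

omit [Fintype α] in
lemma count_nonneg {n : ℕ} (s : Fin n → α) (a : α) : 0 ≤ count s a :=
  Finset.sum_nonneg fun _ _ => ind_nonneg _

omit [Fintype α] in
lemma count_pos {n : ℕ} (s : Fin n → α) (t : Fin n) : 0 < count s (s t) := by
  refine Finset.sum_pos' (fun _ _ => ind_nonneg _) ⟨t, Finset.mem_univ t, ?_⟩
  rw [ind_of rfl]
  exact one_pos

lemma sum_count_mul {n : ℕ} (s : Fin n → α) (f : α → ℝ) :
    ∑ a, count s a * f a = ∑ t, f (s t) := by
  simp_rw [count, Finset.sum_mul]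
  rw [Finset.sum_comm]
  exact Finset.sum_congr rfl fun t _ => sum_ind_eq (s t) f

lemma highProb_near {p : α → ℝ} (hp : ∀ a, 0 ≤ p a) (hp1 : ∑ a, p a = 1) (π : α → β) {δ : ℝ}
    (hδ : 0 < δ) : HighProb p fun _ s => Near δ (push π p) fun t => π (s t) :=
  HighProb.forall hp fun b => highProb_mean hp hp1 (fun a => ind (π a = b)) hδ

omit [Fintype α] in
lemma emp_nonneg {n : ℕ} (s : Fin n → α) (a : α) : 0 ≤ emp s a :=
  div_nonneg (count_nonneg s a) (Nat.cast_nonneg n)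

omit [Fintype α] in
lemma emp_pos {n : ℕ} (s : Fin n → α) (t : Fin n) : 0 < emp s (s t) :=
  div_pos (count_pos s t) (by exact_mod_cast t.pos)

lemma sum_emp {n : ℕ} (hn : 0 < n) (s : Fin n → α) : ∑ a, emp s a = 1 := by
  have h := sum_count_mul s fun _ => (1 : ℝ)
  simp only [mul_one, Finset.sum_const, Finset.card_univ, Fintype.card_fin, nsmul_eq_mul] at h
  simp_rw [emp]
  rw [← Finset.sum_div, h, div_self (by positivity)]

omit [Fintype β] in
lemma push_emp {n : ℕ} (s : Fin n → α) (π : α → β) (b : β) :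
    push π (emp s) b = count (fun t => π (s t)) b / n := by
  simp_rw [push, emp, div_mul_eq_mul_div]
  rw [← Finset.sum_div, sum_count_mul s fun a => ind (π a = b), count]

/-- The empirical pmf depends only on the vector of counts, which takes at most `(n + 1) ^ |α|`
values. On the sequences with a given vector the summand is the i.i.d. probability under one fixed
pmf, so each class contributes at most `1`. -/
lemma sum_prod_emp_le {n : ℕ} (hn : 0 < n) :
    ∑ s : Fin n → α, ∏ t, emp s (s t) ≤ ((n : ℝ) + 1) ^ Fintype.card α := by
  classical
  let code : (Fin n → α) → α → Fin (n + 1) := fun s a =>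
    ⟨(Finset.univ.filter fun t => s t = a).card,
      Nat.lt_succ_of_le ((Finset.card_le_univ _).trans_eq (Fintype.card_fin n))⟩
  have hcode : ∀ s a, emp s a = ((code s a : ℕ) : ℝ) / n := by
    intro s a
    rw [emp, count]
    congr 1
    simp [code, ind]
  rw [← sum_fiber code fun _ s => ∏ t, emp s (s t)]
  have hc : ∀ c : α → Fin (n + 1),
      ∑ s : Fin n → α, ind (code s = c) * ∏ t, emp s (s t) ≤ 1 := by
    intro c
    by_cases h : ∃ s₀, code s₀ = c
    · obtain ⟨s₀, rfl⟩ := h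
      rw [← sum_iid (sum_emp hn s₀) n]
      refine Finset.sum_le_sum fun s _ => ?_
      by_cases hs : code s = code s₀
      · rw [ind_of hs, one_mul]
        have : emp s = emp s₀ := by funext a; rw [hcode, hcode, hs]
        rw [this]
      · rw [ind_of_not hs, zero_mul]
        exact Finset.prod_nonneg fun t _ => emp_nonneg _ _
    · push Not at h
      refine (Finset.sum_eq_zero fun s _ => ?_).trans_le zero_le_one
      rw [ind_of_not (h s), zero_mul]
  refine (Finset.sum_le_sum fun c _ => hc c).trans ?_
  simp

/-- The log-ratio of the two products is a sum over positions; grouping equal letters turns it into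
`n` times a divergence. -/
lemma prod_eq_exp_div {n : ℕ} {q : α → ℝ} (s : Fin n → α)
    (hs : ∀ t, 0 < q (s t)) :
    ∏ t, q (s t) = Real.exp (-(n * div (emp s) q)) * ∏ t, emp s (s t) := by
  have h : (n : ℝ) * div (emp s) q = ∑ t, Real.log (emp s (s t) / q (s t)) := by
    rw [← sum_count_mul s fun a => Real.log (emp s a / q a), div, Finset.mul_sum]
    refine Finset.sum_congr rfl fun a _ => ?_
    rcases Nat.eq_zero_or_pos n with h0 | h0
    · subst h0
      simp [count]
    · rw [← mul_assoc, emp, mul_div_cancel₀]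
      positivity
  rw [h, Real.exp_neg, Real.exp_sum, ← Finset.prod_inv_distrib, ← Finset.prod_mul_distrib]
  refine Finset.prod_congr rfl fun t _ => ?_
  have h1 := emp_pos s t
  rw [Real.exp_log (div_pos h1 (hs t)), inv_div, div_mul_cancel₀ _ h1.ne']

theorem sum_iid_le_of_div {n : ℕ} (hn : 0 < n) {q : α → ℝ} (hq : ∀ a, 0 ≤ q a)
    (E : (Fin n → α) → Prop) {θ : ℝ}
    (hE : ∀ s, E s → (∀ t, 0 < q (s t)) → θ ≤ div (emp s) q) :
    ∑ s : Fin n → α, (∏ t, q (s t)) * ind (E s) ≤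
      ((n : ℝ) + 1) ^ Fintype.card α * Real.exp (-(n * θ)) := by
  refine le_trans ?_ (mul_le_mul_of_nonneg_right (sum_prod_emp_le hn) (Real.exp_pos _).le)
  rw [Finset.sum_mul]
  refine Finset.sum_le_sum fun s _ => ?_
  have hemp : 0 ≤ ∏ t, emp s (s t) := Finset.prod_nonneg fun t _ => emp_nonneg _ _
  by_cases hpos : ∀ t, 0 < q (s t)
  · by_cases hs : E s
    · rw [ind_of hs, mul_one, prod_eq_exp_div s hpos, mul_comm]
      refine mul_le_mul_of_nonneg_left (Real.exp_le_exp.2 ?_) hemp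
      have := mul_le_mul_of_nonneg_left (hE s hs hpos) (Nat.cast_nonneg (α := ℝ) n)
      linarith
    · rw [ind_of_not hs, mul_zero]
      positivity
  · push Not at hpos
    obtain ⟨t, ht⟩ := hpos
    rw [Finset.prod_eq_zero (Finset.mem_univ t) (le_antisymm ht (hq _)), zero_mul]
    positivity

/-! ### Lower semicontinuity of the exponent -/

/-- Continuity holds everywhere because `t * log t` extends continuously to `0` and a letter with `q
a = 0` contributes `0` by the convention `x / 0 = 0`. Hence `div` is the true divergence only under
absolute continuity, which is therefore carried as a separate condition below. -/
lemma continuous_div (q : α → ℝ) : Continuous fun T => div T q := by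
  refine continuous_finsetSum _ fun a _ => ?_
  by_cases ha : q a = 0
  · simp only [ha, div_zero, Real.log_zero, mul_zero]
    exact continuous_const
  · have e : (fun T : α → ℝ => T a * Real.log (T a / q a)) =
        fun T => T a * Real.log (T a) - T a * Real.log (q a) := by
      funext T
      by_cases hT : T a = 0
      · simp [hT]
      · rw [Real.log_div hT ha, mul_sub]
    rw [e]
    exact (Real.continuous_mul_log.comp (continuous_apply a)).sub
      ((continuous_apply a).mul continuous_const)

/-- The pmfs with divergence at most `θ - ε` form a compact set on which `m` is positive, so `m` has
a positive minimum there; half of it serves as `δ`. -/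
theorem exists_div_gt (q : α → ℝ) {m : (α → ℝ) → ℝ} (hm : Continuous m) {θ : ℝ}
    (h : ∀ T ∈ stdSimplex ℝ α, (∀ a, q a = 0 → T a = 0) → m T ≤ 0 → θ ≤ div T q)
    {ε : ℝ} (hε : 0 < ε) :
    ∃ δ > 0, ∀ T ∈ stdSimplex ℝ α, (∀ a, q a = 0 → T a = 0) → m T ≤ δ → θ - ε ≤ div T q := by
  set C : Set (α → ℝ) := stdSimplex ℝ α ∩
    ({T | ∀ a, q a = 0 → T a = 0} ∩ {T | div T q ≤ θ - ε}) with hC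
  have hCc : IsCompact C := by
    refine (isCompact_stdSimplex ℝ α).inter_right (IsClosed.inter ?_ ?_)
    · simp only [Set.ofPred_forall]
      exact isClosed_iInter fun a => isClosed_iInter fun _ =>
        isClosed_eq (continuous_apply a) continuous_const
    · exact isClosed_le (continuous_div q) continuous_const
  rcases C.eq_empty_or_nonempty with h0 | h0
  · refine ⟨1, one_pos, fun T hT hac _ => ?_⟩
    by_contra hlt
    have : T ∈ C := ⟨hT, hac, (not_le.1 hlt).le⟩
    simp [h0] at this
  · obtain ⟨T₀, hT₀, hmin⟩ := hCc.exists_isMinOn h0 hm.continuousOn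
    have hm0 : 0 < m T₀ := by
      by_contra hle
      have h1 := h T₀ hT₀.1 hT₀.2.1 (not_lt.1 hle)
      have h2 : div T₀ q ≤ θ - ε := hT₀.2.2
      linarith
    refine ⟨m T₀ / 2, by positivity, fun T hT hac hmT => ?_⟩
    by_contra hlt
    have : m T₀ ≤ m T := hmin (⟨hT, hac, (not_le.1 hlt).le⟩ : T ∈ C)
    linarith

/-- The distance between the image of `T` under `π` and `q`. -/
noncomputable def pushDist (π : α → β) (q : β → ℝ) (T : α → ℝ) : ℝ := ∑ b, |push π T b - q b|

lemma continuous_pushDist (π : α → β) (q : β → ℝ) : Continuous (pushDist π q) := by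
  unfold pushDist push
  fun_prop

lemma pushDist_nonneg (π : α → β) (q : β → ℝ) (T : α → ℝ) : 0 ≤ pushDist π q T :=
  Finset.sum_nonneg fun _ _ => abs_nonneg _

lemma push_eq_of_pushDist_le {π : α → β} {q : β → ℝ} {T : α → ℝ} (h : pushDist π q T ≤ 0)
    (b : β) : push π T b = q b := by
  have h0 := le_antisymm h (pushDist_nonneg π q T)
  have := (Finset.sum_eq_zero_iff_of_nonneg fun _ _ => abs_nonneg _).1 h0 b (Finset.mem_univ b)
  exact sub_eq_zero.1 (abs_eq_zero.1 this)

lemma Near.pushDist_emp_le {n : ℕ} (hn : 0 < n) {π : α → β} {q : β → ℝ} {s : Fin n → α} {δ : ℝ}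
    (h : Near δ q fun t => π (s t)) : pushDist π q (emp s) ≤ Fintype.card β * δ := by
  have hn' : (0 : ℝ) < n := by exact_mod_cast hn
  have : ∀ b, |push π (emp s) b - q b| ≤ δ := by
    intro b
    have e : push π (emp s) b - q b = (count (fun t => π (s t)) b - n * q b) / n := by
      rw [push_emp]
      field_simp
    rw [e, abs_div, abs_of_pos hn', div_le_iff₀ hn', mul_comm δ]
    exact h b
  refine (Finset.sum_le_sum fun b _ => this b).trans ?_
  simp

end Iid

/-! ### Finite pmfs as real-valued weights -/

section Weights

variable {Ω α β γ : Type*}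

/-- The real-valued weights of a pmf. -/
noncomputable def wt (Q : PMF α) (a : α) : ℝ := (Q a).toReal

lemma wt_nonneg (Q : PMF α) (a : α) : 0 ≤ wt Q a := ENNReal.toReal_nonneg

lemma ofReal_wt (Q : PMF α) (a : α) : ENNReal.ofReal (wt Q a) = Q a :=
  ENNReal.ofReal_toReal (Q.apply_ne_top a)

lemma sum_wt [Fintype α] (Q : PMF α) : ∑ a, wt Q a = 1 := by
  unfold wt
  have h := Q.tsum_coe
  rw [tsum_fintype] at h
  rw [← ENNReal.toReal_sum fun a _ => Q.apply_ne_top a, h, ENNReal.toReal_one]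

lemma wt_map [Fintype α] (Q : PMF α) (f : α → β) (b : β) :
    wt (Q.map f) b = ∑ a, wt Q a * ind (f a = b) := by
  classical
  rw [wt, PMF.map_apply, tsum_fintype, ENNReal.toReal_sum]
  · refine Finset.sum_congr rfl fun a _ => ?_
    by_cases h : f a = b
    · rw [if_pos h.symm, ind_of h, mul_one, wt]
    · rw [if_neg (Ne.symm h), ind_of_not h, mul_zero, ENNReal.toReal_zero]
  · intro a _
    split_ifs
    · exact Q.apply_ne_top a
    · exact ENNReal.zero_ne_top

lemma wt_le_wt_map [Fintype α] (Q : PMF α) (f : α → β) (a : α) :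
    wt Q a ≤ wt (Q.map f) (f a) := by
  rw [wt_map]
  refine le_trans (le_of_eq ?_) (Finset.single_le_sum
    (fun a _ => mul_nonneg (wt_nonneg Q a) (ind_nonneg _)) (Finset.mem_univ a))
  rw [ind_of rfl, mul_one]

lemma wt_map_le_wt_map [Fintype Ω] (Q : PMF Ω) (f : Ω → α) (g : Ω → β) {a : α} {b : β}
    (h : ∀ ω, f ω = a → g ω = b) : wt (Q.map f) a ≤ wt (Q.map g) b := by
  rw [wt_map, wt_map]
  exact Finset.sum_le_sum fun ω _ =>
    mul_le_mul_of_nonneg_left (ind_mono (h ω)) (wt_nonneg Q ω)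

lemma wt_map_eq_wt_map [Fintype Ω] (Q : PMF Ω) (f : Ω → α) (g : Ω → β) {a : α} {b : β}
    (h : ∀ ω, f ω = a ↔ g ω = b) : wt (Q.map f) a = wt (Q.map g) b :=
  le_antisymm (wt_map_le_wt_map Q f g fun ω => (h ω).1)
    (wt_map_le_wt_map Q g f fun ω => (h ω).2)

lemma sum_wt_law₂ [Fintype Ω] [Fintype α] (Q : PMF Ω) (f : Ω → α) (g : Ω → β) (b : β) :
    ∑ a, wt (law₂ Q f g) (a, b) = wt (Q.map g) b := by
  simp_rw [law₂, wt_map]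
  rw [Finset.sum_comm]
  refine Finset.sum_congr rfl fun ω _ => ?_
  rw [← Finset.mul_sum]
  have := sum_ind_eq (f ω) fun _ => ind (g ω = b)
  simp_rw [Prod.mk.injEq, ind_and, this]

/-- A common conditional pmf of `f` given `g` under two laws. -/
lemma exists_kernel [Fintype Ω] [Fintype α] {Q Qbar : PMF Ω} {f : Ω → α} {g : Ω → β}
    (h : SameCond Q Qbar f g) :
    ∃ w : β → α → ℝ, (∀ b a, 0 ≤ w b a) ∧ (∀ b, ∑ a, w b a = 1) ∧
      (∀ a b, wt (law₂ Q f g) (a, b) = wt (Q.map g) b * w b a) ∧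
      ∀ a b, wt (law₂ Qbar f g) (a, b) = wt (Qbar.map g) b * w b a := by
  have hzero : ∀ (R : PMF Ω) a b, wt (R.map g) b = 0 → wt (law₂ R f g) (a, b) = 0 := by
    intro R a b hb
    refine le_antisymm (hb ▸ ?_) (wt_nonneg _ _)
    exact wt_map_le_wt_map R _ _ fun ω hω => (Prod.ext_iff.1 hω).2
  have key : ∀ b, ∃ w : α → ℝ, (∀ a, 0 ≤ w a) ∧ (∑ a, w a = 1) ∧
      (∀ a, wt (law₂ Q f g) (a, b) = wt (Q.map g) b * w a) ∧
      ∀ a, wt (law₂ Qbar f g) (a, b) = wt (Qbar.map g) b * w a := by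
    intro b
    have hdiv : ∀ R : PMF Ω, wt (R.map g) b ≠ 0 →
        (∀ a, 0 ≤ wt (law₂ R f g) (a, b) / wt (R.map g) b) ∧
        (∑ a, wt (law₂ R f g) (a, b) / wt (R.map g) b = 1) ∧
        ∀ a, wt (law₂ R f g) (a, b) = wt (R.map g) b * (wt (law₂ R f g) (a, b) / wt (R.map g) b) :=
      fun R hR => ⟨fun a => div_nonneg (wt_nonneg _ _) (wt_nonneg _ _),
        by rw [← Finset.sum_div, sum_wt_law₂, div_self hR], fun a => (mul_div_cancel₀ _ hR).symm⟩
    -- The kernel at `b` is read off from a law that charges `b`; if both do, `SameCond` makes them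
    -- agree. If neither does, any pmf is admissible, here the law of `f`.
    by_cases hb : wt (Q.map g) b = 0
    · by_cases hb' : wt (Qbar.map g) b = 0
      · exact ⟨wt (Q.map f), wt_nonneg _, sum_wt _,
          fun a => by rw [hzero Q a b hb, hb, zero_mul],
          fun a => by rw [hzero Qbar a b hb', hb', zero_mul]⟩
      · obtain ⟨h1, h2, h3⟩ := hdiv Qbar hb'
        exact ⟨_, h1, h2, fun a => by rw [hzero Q a b hb, hb, zero_mul], h3⟩
    · obtain ⟨h1, h2, h3⟩ := hdiv Q hb
      refine ⟨_, h1, h2, h3, fun a => ?_⟩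
      have e := congrArg ENNReal.toReal (h a b)
      rw [ENNReal.toReal_mul, ENNReal.toReal_mul] at e
      change wt (law₂ Qbar f g) (a, b) * wt (Q.map g) b =
        wt (law₂ Q f g) (a, b) * wt (Qbar.map g) b at e
      field_simp
      linarith
  choose w h1 h2 h3 h4 using key
  exact ⟨w, h1, h2, fun a b => h3 b a, fun a b => h4 b a⟩

lemma IsMarkov.wt_law₃ [Fintype Ω] {Q : PMF Ω} {f : Ω → α} {g : Ω → β} {h : Ω → γ}
    (hm : IsMarkov Q f g h) {w : β → α → ℝ}
    (hw : ∀ a b, wt (law₂ Q f g) (a, b) = wt (Q.map g) b * w b a) (a : α) (b : β) (c : γ) :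
    wt (law₃ Q f g h) (a, b, c) = wt (law₂ Q g h) (b, c) * w b a := by
  have e := congrArg ENNReal.toReal (hm a b c)
  rw [ENNReal.toReal_mul, ENNReal.toReal_mul] at e
  change wt (law₃ Q f g h) (a, b, c) * wt (Q.map g) b =
    wt (law₂ Q f g) (a, b) * wt (law₂ Q g h) (b, c) at e
  by_cases hb : wt (Q.map g) b = 0
  · have h3 : wt (law₃ Q f g h) (a, b, c) = 0 := by
      refine le_antisymm (hb ▸ ?_) (wt_nonneg _ _)
      exact wt_map_le_wt_map Q _ _ fun ω hω => (Prod.ext_iff.1 (Prod.ext_iff.1 hω).2).1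
    have h2 : wt (law₂ Q g h) (b, c) = 0 := by
      refine le_antisymm (hb ▸ ?_) (wt_nonneg _ _)
      exact wt_map_le_wt_map Q _ _ fun ω hω => (Prod.ext_iff.1 hω).1
    rw [h3, h2, zero_mul]
  · rw [hw] at e
    refine mul_right_cancel₀ hb ?_
    rw [e]
    ring

/-! ### Information measures as sums -/

lemma entropy_map [Fintype Ω] [Fintype α] (Q : PMF Ω) (f : Ω → α) :
    entropy (Q.map f) = -∑ ω, wt Q ω * Real.log (wt (Q.map f) (f ω)) := by
  have h : ∑ ω, wt Q ω * Real.log (wt (Q.map f) (f ω)) =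
      ∑ a, wt (Q.map f) a * Real.log (wt (Q.map f) a) := by
    rw [← sum_fiber f fun a ω => wt Q ω * Real.log (wt (Q.map f) a)]
    refine Finset.sum_congr rfl fun a _ => ?_
    rw [wt_map Q f a, Finset.sum_mul]
    exact Finset.sum_congr rfl fun ω _ => by ring
  rw [h, entropy, ← Finset.sum_neg_distrib]
  exact Finset.sum_congr rfl fun a _ => by rw [Real.negMulLog, wt]; ring

/-- On the support of `Q` the three entropy logarithms combine through the factorization of the pair
law. In this form the information is the mean of a single-letter log-ratio, to which the weak law of
large numbers applies. -/
lemma mutualInfo_eq [Fintype Ω] [Fintype α] [Fintype β] (Q : PMF Ω) (f : Ω → α) (g : Ω → β)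
    {w : β → α → ℝ}
    (hw : ∀ a b, wt (law₂ Q f g) (a, b) = wt (Q.map g) b * w b a) :
    mutualInfo Q f g = ∑ ω, wt Q ω * Real.log (w (g ω) (f ω) / wt (Q.map f) (f ω)) := by
  rw [mutualInfo, law₂, entropy_map, entropy_map, entropy_map, sub_neg_eq_add,
    ← Finset.sum_neg_distrib, ← Finset.sum_neg_distrib, ← Finset.sum_add_distrib,
    ← Finset.sum_add_distrib]
  refine Finset.sum_congr rfl fun ω _ => ?_
  rcases (wt_nonneg Q ω).eq_or_lt with h0 | h0
  · simp [← h0]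
  have h1 := h0.trans_le (wt_le_wt_map Q f ω)
  have h2 := h0.trans_le (wt_le_wt_map Q g ω)
  have h3 : 0 < wt (law₂ Q f g) (f ω, g ω) :=
    h0.trans_le (wt_le_wt_map Q (fun ω => (f ω, g ω)) ω)
  have e := hw (f ω) (g ω)
  rw [e] at h3
  have h4 := pos_of_mul_pos_right h3 h2.le
  rw [law₂] at e
  rw [e, Real.log_div h4.ne' h1.ne', Real.log_mul h2.ne' h4.ne']
  ring

lemma condMutualInfo_eq [Fintype Ω] [Fintype α] [Fintype β] [Fintype γ] (Q : PMF Ω)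
    (f : Ω → α) (g : Ω → β) (h : Ω → γ) {w : β × γ → α → ℝ} {k : γ → α → ℝ}
    (hw : ∀ a b, wt (law₂ Q f fun ω => (g ω, h ω)) (a, b) =
      wt (Q.map fun ω => (g ω, h ω)) b * w b a)
    (hk : ∀ a c, wt (law₂ Q f h) (a, c) = wt (Q.map h) c * k c a) :
    condMutualInfo Q f g h =
      ∑ ω, wt Q ω * Real.log (w (g ω, h ω) (f ω) / k (h ω) (f ω)) := by
  rw [condMutualInfo, law₂, law₂, law₃, entropy_map, entropy_map, entropy_map, entropy_map,
    sub_neg_eq_add, sub_neg_eq_add,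
    ← Finset.sum_neg_distrib, ← Finset.sum_neg_distrib, ← Finset.sum_add_distrib,
    ← Finset.sum_add_distrib, ← Finset.sum_add_distrib]
  refine Finset.sum_congr rfl fun ω _ => ?_
  rcases (wt_nonneg Q ω).eq_or_lt with h0 | h0
  · simp [← h0]
  have h1 := h0.trans_le (wt_le_wt_map Q h ω)
  have h2 := h0.trans_le (wt_le_wt_map Q (fun ω => (g ω, h ω)) ω)
  have h3 : 0 < wt (law₂ Q f fun ω => (g ω, h ω)) (f ω, g ω, h ω) :=
    h0.trans_le (wt_le_wt_map Q (fun ω => (f ω, g ω, h ω)) ω)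
  have h5 : 0 < wt (law₂ Q f h) (f ω, h ω) :=
    h0.trans_le (wt_le_wt_map Q (fun ω => (f ω, h ω)) ω)
  have e := hw (f ω) (g ω, h ω)
  have e' := hk (f ω) (h ω)
  rw [e] at h3
  rw [e'] at h5
  have h4 := pos_of_mul_pos_right h3 h2.le
  have h6 := pos_of_mul_pos_right h5 h1.le
  rw [law₂] at e e'
  rw [e, e', Real.log_div h4.ne' h6.ne', Real.log_mul h2.ne' h4.ne', Real.log_mul h1.ne' h6.ne']
  ring

/-- Gibbs' inequality. -/
lemma sum_mul_log_div_nonneg [Fintype α] {q q' : α → ℝ} (hq : ∀ a, 0 ≤ q a)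
    (hq' : ∀ a, 0 ≤ q' a) (h1 : ∑ a, q a = 1) (h1' : ∑ a, q' a ≤ 1)
    (hac : ∀ a, 0 < q a → 0 < q' a) : 0 ≤ ∑ a, q a * Real.log (q a / q' a) := by
  have h : ∀ a, q a - q' a ≤ q a * Real.log (q a / q' a) := by
    intro a
    rcases (hq a).eq_or_lt with h0 | h0
    · simp [← h0, hq' a]
    · have h2 := hac a h0
      have h3 := Real.one_sub_inv_le_log_of_pos (div_pos h0 h2)
      rw [inv_div] at h3
      have h4 := mul_le_mul_of_nonneg_left h3 h0.le
      rwa [mul_sub, mul_one, mul_div_cancel₀ _ h0.ne'] at h4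
  have := Finset.sum_le_sum fun a (_ : a ∈ Finset.univ) => h a
  rw [Finset.sum_sub_distrib] at this
  linarith

/-- The ratio of the pmfs is the Radon–Nikodym density, and the mass correction in `klDiv` vanishes
for probability measures. -/
lemma kl_eq [Fintype α] (T Q : PMF α) (h : ∀ a, wt Q a = 0 → wt T a = 0) :
    kl T Q = ENNReal.ofReal (∑ a, wt T a * Real.log (wt T a / wt Q a)) := by
  let _ : MeasurableSpace α := ⊤
  have h' : ∀ a, Q a = 0 → T a = 0 := fun a ha => by
    have := h a (by rw [wt, ha, ENNReal.toReal_zero])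
    exact (ENNReal.toReal_eq_zero_iff _).1 this |>.resolve_right (T.apply_ne_top a)
  have hd : Q.toMeasure.withDensity (fun a => T a / Q a) = T.toMeasure := by
    refine MeasureTheory.Measure.ext_of_singleton fun a => ?_
    rw [MeasureTheory.withDensity_apply _ (measurableSet_singleton a),
      MeasureTheory.lintegral_singleton,
      PMF.toMeasure_apply_singleton _ _ (measurableSet_singleton a),
      PMF.toMeasure_apply_singleton _ _ (measurableSet_singleton a)]
    by_cases hQ : Q a = 0
    · rw [hQ, mul_zero, h' a hQ]
    · exact ENNReal.div_mul_cancel hQ (Q.apply_ne_top a)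
  have hac : MeasureTheory.Measure.AbsolutelyContinuous T.toMeasure Q.toMeasure :=
    hd ▸ MeasureTheory.withDensity_absolutelyContinuous _ _
  have hrn : T.toMeasure.rnDeriv Q.toMeasure =ᵐ[Q.toMeasure] fun a => T a / Q a := by
    have := MeasureTheory.Measure.rnDeriv_withDensity Q.toMeasure
      (f := fun a => T a / Q a) (fun _ _ => trivial)
    rwa [hd] at this
  have hllr : MeasureTheory.llr T.toMeasure Q.toMeasure =ᵐ[T.toMeasure]
      fun a => Real.log (wt T a / wt Q a) := by
    filter_upwards [hac.ae_le hrn] with a ha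
    rw [MeasureTheory.llr, ha, ENNReal.toReal_div, wt, wt]
  have e : kl T Q = InformationTheory.klDiv T.toMeasure Q.toMeasure := rfl
  rw [e, InformationTheory.klDiv_of_ac_of_integrable hac
    ((MeasureTheory.integrable_congr hllr).2 MeasureTheory.Integrable.of_finite),
    MeasureTheory.integral_congr_ae hllr, PMF.integral_eq_sum]
  simp [wt]

/-- The pmf with given weights. -/
lemma exists_wt_eq [Fintype α] {T : α → ℝ} (h0 : ∀ a, 0 ≤ T a) (h1 : ∑ a, T a = 1) :
    ∃ R : PMF α, ∀ a, wt R a = T a := by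
  refine ⟨PMF.ofFintype (fun a => ENNReal.ofReal (T a)) ?_, fun a => ?_⟩
  · rw [← ENNReal.ofReal_sum_of_nonneg fun a _ => h0 a, h1, ENNReal.ofReal_one]
  · rw [wt, PMF.ofFintype_apply, ENNReal.toReal_ofReal (h0 a)]

lemma ext_wt {Q R : PMF α} (h : ∀ a, wt Q a = wt R a) : Q = R :=
  PMF.ext fun a => by rw [← ofReal_wt, h, ofReal_wt]

lemma iidProb_eq [Fintype α] (P : PMF α) {n : ℕ} (A : Set (Fin n → α)) :
    iidProb P A = ENNReal.ofReal (∑ s : Fin n → α, (∏ t, wt P (s t)) * ind (s ∈ A)) := by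
  rw [ENNReal.ofReal_sum_of_nonneg fun s _ =>
    mul_nonneg (Finset.prod_nonneg fun t _ => wt_nonneg _ _) (ind_nonneg _), iidProb]
  refine Finset.sum_congr rfl fun s _ => ?_
  by_cases hs : s ∈ A
  · rw [Set.indicator_of_mem hs, ind_of hs, mul_one,
      ENNReal.ofReal_prod_of_nonneg fun t _ => wt_nonneg _ _]
    simp_rw [ofReal_wt]
  · rw [Set.indicator_of_notMem hs, ind_of_not hs, mul_zero, ENNReal.ofReal_zero]

end Weights

/-! ### Product laws on sequences and Sanov's bound -/

section Products

variable {α β : Type*} [Fintype α] [Fintype β]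

lemma sum_prod_fun {n : ℕ} (F : Fin n → α → ℝ) :
    ∑ s : Fin n → α, ∏ t, F t (s t) = ∏ t, ∑ a, F t a := by
  classical
  rw [Finset.prod_univ_sum, Fintype.piFinset_univ]

omit [Fintype β] in
lemma sum_prod_kernel {w : β → α → ℝ} (hw : ∀ b, ∑ a, w b a = 1) {n : ℕ} (x : Fin n → β) :
    ∑ s : Fin n → α, ∏ t, w (x t) (s t) = 1 := by
  rw [sum_prod_fun fun t a => w (x t) a]
  exact Finset.prod_eq_one fun t _ => hw _

lemma sum_iid_push (p : α → ℝ) (π : α → β) {n : ℕ} (G : (Fin n → β) → ℝ) :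
    ∑ s : Fin n → α, (∏ t, p (s t)) * G (fun t => π (s t)) =
      ∑ s : Fin n → β, (∏ t, push π p (s t)) * G s := by
  rw [← sum_fiber (fun (s : Fin n → α) t => π (s t)) fun s' s => (∏ t, p (s t)) * G s']
  refine Finset.sum_congr rfl fun s' _ => ?_
  simp_rw [push]
  rw [← sum_prod_fun fun t a => p a * ind (π a = s' t), Finset.sum_mul]
  refine Finset.sum_congr rfl fun s _ => ?_
  rw [Finset.prod_mul_distrib, ← ind_forall]
  simp_rw [funext_iff]
  ring

/-- Law of large numbers for the log-likelihood ratio. The first bound supplies the domination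
constant needed for covering; the second pays for replacing the codeword law by the test channel. -/
lemma highProb_prod_le {p : α → ℝ} (hp : ∀ a, 0 ≤ p a) (hp1 : ∑ a, p a = 1) {a b : α → ℝ}
    (hab : ∀ i, 0 < p i → 0 < a i ∧ 0 < b i) {I : ℝ} (hI : I = ∑ i, p i * Real.log (a i / b i))
    {δ : ℝ} (hδ : 0 < δ) :
    HighProb p fun n s => ∏ t, a (s t) ≤ Real.exp (n * (I + δ)) * ∏ t, b (s t) ∧
      ∏ t, b (s t) ≤ Real.exp (-(n * (I - δ))) * ∏ t, a (s t) := by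
  refine (highProb_mean hp hp1 (fun i => Real.log (a i / b i)) hδ).mono hp ?_
  intro n s hs h
  rw [← hI] at h
  have hpos : ∀ t, 0 < p (s t) := by
    intro t
    refine lt_of_le_of_ne (hp _) fun h0 => hs.ne' ?_
    exact Finset.prod_eq_zero (Finset.mem_univ t) h0.symm
  have ha : 0 < ∏ t, a (s t) := Finset.prod_pos fun t _ => (hab _ (hpos t)).1
  have hb : 0 < ∏ t, b (s t) := Finset.prod_pos fun t _ => (hab _ (hpos t)).2
  have e : ∏ t, a (s t) = Real.exp (∑ t, Real.log (a (s t) / b (s t))) * ∏ t, b (s t) := by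
    rw [Real.exp_sum, ← Finset.prod_mul_distrib]
    refine Finset.prod_congr rfl fun t _ => ?_
    obtain ⟨h1, h2⟩ := hab _ (hpos t)
    rw [Real.exp_log (div_pos h1 h2), div_mul_cancel₀ _ h2.ne']
  obtain ⟨h1, h2⟩ := abs_le.1 h
  constructor
  · rw [e]
    refine mul_le_mul_of_nonneg_right (Real.exp_le_exp.2 ?_) hb.le
    linarith
  · rw [e, ← mul_assoc, ← Real.exp_add]
    refine le_mul_of_one_le_left hb.le (Real.one_le_exp ?_)
    linarith

/-- Sanov's upper bound for a closed condition on the empirical pmf. -/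
theorem exists_sum_iid_le {q : α → ℝ} (hq : ∀ a, 0 ≤ q a) {m : (α → ℝ) → ℝ} (hm : Continuous m)
    {θ : ℝ} (h : ∀ T ∈ stdSimplex ℝ α, (∀ a, q a = 0 → T a = 0) → m T ≤ 0 → θ ≤ div T q)
    {ε : ℝ} (hε : 0 < ε) :
    ∃ δ > 0, ∀ n : ℕ, 0 < n → ∀ E : (Fin n → α) → Prop, (∀ s, E s → m (emp s) ≤ δ) →
      ∑ s : Fin n → α, (∏ t, q (s t)) * ind (E s) ≤
        ((n : ℝ) + 1) ^ Fintype.card α * Real.exp (-(n * (θ - ε))) := by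
  obtain ⟨δ, hδ, hT⟩ := exists_div_gt q hm h hε
  refine ⟨δ, hδ, fun n hn E hE => sum_iid_le_of_div hn hq E fun s hs hpos => ?_⟩
  refine hT _ ⟨emp_nonneg s, sum_emp hn s⟩ (fun a ha => ?_) (hE s hs)
  have : ∀ t, s t ≠ a := by
    rintro t rfl
    exact (hpos t).ne' ha
  rw [emp, count, Finset.sum_eq_zero fun t _ => ind_of_not (this t), zero_div]

omit [Fintype β] in
lemma wt_map_eq_push (Q : PMF α) (f : α → β) : wt (Q.map f) = push f (wt Q) :=
  funext fun b => wt_map Q f b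

/-- `ENNReal.ofReal` reflects the inequality because the divergence on the right is nonnegative by
Gibbs' inequality. -/
lemma le_div_of_le_kl {Q : PMF α} {θ : ℝ} {R : PMF α} (h : ENNReal.ofReal θ ≤ kl R Q)
    (hac : ∀ a, wt Q a = 0 → wt R a = 0) : θ ≤ div (wt R) (wt Q) := by
  rw [kl_eq R Q hac] at h
  refine (ENNReal.ofReal_le_ofReal_iff ?_).1 h
  refine sum_mul_log_div_nonneg (wt_nonneg R) (wt_nonneg Q) (sum_wt R) (sum_wt Q).le ?_
  intro a ha
  exact lt_of_le_of_ne (wt_nonneg Q a) fun h0 => ha.ne' (hac a h0.symm)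

end Products

/-! ### Single-letter factorization through test channels -/

section Factorization

variable {𝒰 𝒱 𝒳 𝒴₁ 𝒴₂ : Type*} [Fintype 𝒰] [Fintype 𝒱] [Fintype 𝒳] [Fintype 𝒴₁] [Fintype 𝒴₂]

/-- The second chain splits off `V` given `(Y₁, U)`, the first then splits off `U` given `X`. -/
lemma wt_eq_of_markovChains {Q : PMF (Tuple 𝒰 𝒱 𝒳 𝒴₁ 𝒴₂)} (hQ : MarkovChains Q)
    {w₁ : 𝒳 → 𝒰 → ℝ} (hw₁ : ∀ u x, wt (law₂ Q U X) (u, x) = wt (Q.map X) x * w₁ x u)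
    {w₂ : 𝒴₁ × 𝒰 → 𝒱 → ℝ}
    (hw₂ : ∀ v b, wt (law₂ Q V fun ω => (Y₁ ω, U ω)) (v, b) =
      wt (Q.map fun ω => (Y₁ ω, U ω)) b * w₂ b v) (u : 𝒰) (v : 𝒱) (s : 𝒳 × 𝒴₁ × 𝒴₂) :
    wt Q (u, v, s) = wt (law₃ Q X Y₁ Y₂) s * w₁ s.1 u * w₂ (s.2.1, u) v := by
  obtain ⟨x, y, z⟩ := s
  have h1 := hQ.1.wt_law₃ hw₁ u x (y, z)
  have h2 := hQ.2.wt_law₃ hw₂ v (y, u) (z, x)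
  have e1 : wt Q (u, v, x, y, z) =
      wt (law₃ Q V (fun ω => (Y₁ ω, U ω)) fun ω => (Y₂ ω, X ω)) (v, (y, u), (z, x)) := by
    conv_lhs => rw [← Q.map_id]
    refine wt_map_eq_wt_map Q _ _ fun ω => ?_
    obtain ⟨u', v', x', y', z'⟩ := ω
    simp only [id, U, V, X, Y₁, Y₂, Prod.mk.injEq]
    tauto
  have e2 : wt (law₂ Q (fun ω => (Y₁ ω, U ω)) fun ω => (Y₂ ω, X ω)) ((y, u), (z, x)) =
      wt (law₃ Q U X fun ω => (Y₁ ω, Y₂ ω)) (u, x, (y, z)) := by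
    refine wt_map_eq_wt_map Q _ _ fun ω => ?_
    obtain ⟨u', v', x', y', z'⟩ := ω
    simp only [U, X, Y₁, Y₂, Prod.mk.injEq]
    tauto
  rw [e1, h2, e2, h1]
  rfl

/-- Single-letter data of the coding scheme: the sources `p`, `pbar`, the test channels `w₁`, `w₂`,
the codeword laws `r`, `k`, and the joint laws `q`, `qbar`. -/
structure Factorization (p pbar : 𝒳 × 𝒴₁ × 𝒴₂ → ℝ) (q qbar : Tuple 𝒰 𝒱 𝒳 𝒴₁ 𝒴₂ → ℝ)
    (w₁ : 𝒳 → 𝒰 → ℝ) (w₂ : 𝒴₁ × 𝒰 → 𝒱 → ℝ) (r : 𝒰 → ℝ) (k : 𝒰 → 𝒱 → ℝ) : Prop where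
  p_nonneg : ∀ s, 0 ≤ p s
  p_sum : ∑ s, p s = 1
  p_marginal : ∀ x, push Prod.fst p x = push Prod.fst pbar x
  q_nonneg : ∀ ω, 0 ≤ q ω
  q_sum : ∑ ω, q ω = 1
  w₁_nonneg : ∀ x u, 0 ≤ w₁ x u
  w₁_sum : ∀ x, ∑ u, w₁ x u = 1
  w₂_nonneg : ∀ b v, 0 ≤ w₂ b v
  w₂_sum : ∀ b, ∑ v, w₂ b v = 1
  r_nonneg : ∀ u, 0 ≤ r u
  r_sum : ∑ u, r u = 1
  k_nonneg : ∀ u v, 0 ≤ k u v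
  k_sum : ∀ u, ∑ v, k u v = 1
  q_eq : ∀ u v s, q (u, v, s) = p s * w₁ s.1 u * w₂ (s.2.1, u) v
  qbar_eq : ∀ u v s, qbar (u, v, s) = pbar s * w₁ s.1 u * w₂ (s.2.1, u) v
  r_pos : ∀ ω, 0 < q ω → 0 < r (U ω)
  k_pos : ∀ ω, 0 < q ω → 0 < k (U ω) (V ω)

theorem exists_factorization {P Pbar : PMF (𝒳 × 𝒴₁ × 𝒴₂)}
    (hX : P.map (fun s => s.1) = Pbar.map (fun s => s.1)) {R₁ R₂ : ℝ}
    {Q Qbar : PMF (Tuple 𝒰 𝒱 𝒳 𝒴₁ 𝒴₂)}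
    (hQ : IsAuxiliary P R₁ R₂ Q) (hQbar : IsAlternative Q Pbar Qbar) :
    ∃ w₁ w₂ r k, Factorization (wt P) (wt Pbar) (wt Q) (wt Qbar) w₁ w₂ r k ∧
      ∑ ω, wt Q ω * Real.log (w₁ (X ω) (U ω) / r (U ω)) ≤ R₁ ∧
      ∑ ω, wt Q ω * Real.log (w₂ (Y₁ ω, U ω) (V ω) / k (U ω) (V ω)) ≤ R₂ := by
  obtain ⟨w₁, hw₁, hw₁1, hq₁, hq₁'⟩ := exists_kernel hQbar.condU
  obtain ⟨w₂, hw₂, hw₂1, hq₂, hq₂'⟩ := exists_kernel hQbar.condV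
  -- Only the disintegration of `(V, U)` under `Q` is wanted, so `Q` is compared with itself.
  obtain ⟨k, hk, hk1, hqk, -⟩ := exists_kernel (Q := Q) (Qbar := Q) (f := V) (g := U)
    fun _ _ => rfl
  refine ⟨w₁, w₂, wt (Q.map U), k, ?_, ?_, ?_⟩
  · refine ⟨wt_nonneg P, sum_wt P, fun x => ?_, wt_nonneg Q, sum_wt Q, hw₁, hw₁1, hw₂, hw₂1, wt_nonneg _, sum_wt _, hk, hk1, ?_, ?_, ?_, ?_⟩
    · rw [← wt_map_eq_push, ← wt_map_eq_push]
      exact congrFun (congrArg wt hX) x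
    · intro u v s
      rw [wt_eq_of_markovChains hQ.markov hq₁ hq₂, hQ.marginal]
    · intro u v s
      rw [wt_eq_of_markovChains hQbar.markov hq₁' hq₂', hQbar.marginal]
    · intro ω hω
      exact hω.trans_le (wt_le_wt_map Q U ω)
    · intro ω hω
      have h : 0 < wt (law₂ Q V U) (V ω, U ω) :=
        hω.trans_le (wt_le_wt_map Q (fun ω => (V ω, U ω)) ω)
      rw [hqk] at h
      exact pos_of_mul_pos_right h (wt_nonneg _ _)
  · rw [← mutualInfo_eq Q U X hq₁]
    exact hQ.rate₁
  · rw [← condMutualInfo_eq Q V Y₁ U hq₂ hqk]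
    exact hQ.rate₂

variable {p pbar : 𝒳 × 𝒴₁ × 𝒴₂ → ℝ} {q qbar : Tuple 𝒰 𝒱 𝒳 𝒴₁ 𝒴₂ → ℝ}
  {w₁ : 𝒳 → 𝒰 → ℝ} {w₂ : 𝒴₁ × 𝒰 → 𝒱 → ℝ} {r : 𝒰 → ℝ} {k : 𝒰 → 𝒱 → ℝ}

namespace Factorization

variable (hF : Factorization p pbar q qbar w₁ w₂ r k)

include hF

lemma w_pos {ω : Tuple 𝒰 𝒱 𝒳 𝒴₁ 𝒴₂} (hω : 0 < q ω) :
    0 < w₁ (X ω) (U ω) ∧ 0 < w₂ (Y₁ ω, U ω) (V ω) ∧ 0 < p ω.2.2 := by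
  obtain ⟨u, v, s⟩ := ω
  rw [hF.q_eq] at hω
  have h1 := hF.p_nonneg s
  have h2 := hF.w₁_nonneg s.1 u
  have h3 := pos_of_mul_pos_right hω (mul_nonneg h1 h2)
  have h4 := pos_of_mul_pos_left hω h3.le
  exact ⟨pos_of_mul_pos_right h4 h1, h3, pos_of_mul_pos_left h4 h2⟩

/-- Gibbs' inequality against the law in which `U` is drawn from `r` independently of the sources
and `V` still comes from `w₂`. -/
lemma rate₁_nonneg : 0 ≤ ∑ ω, q ω * Real.log (w₁ (X ω) (U ω) / r (U ω)) := by
  have h := sum_mul_log_div_nonneg (q := q)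
    (q' := fun ω => p ω.2.2 * r ω.1 * w₂ (ω.2.2.2.1, ω.1) ω.2.1) hF.q_nonneg
    (fun ω => mul_nonneg (mul_nonneg (hF.p_nonneg _) (hF.r_nonneg _)) (hF.w₂_nonneg _ _))
    hF.q_sum ?_ ?_
  · refine h.trans_eq (Finset.sum_congr rfl fun ω _ => ?_)
    rcases (hF.q_nonneg ω).eq_or_lt with h0 | h0
    · simp [← h0]
    obtain ⟨h1, h2, h3⟩ := hF.w_pos h0
    have h4 := hF.r_pos ω h0
    have e := hF.q_eq ω.1 ω.2.1 ω.2.2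
    simp only [Prod.mk.eta] at e
    congr 2
    rw [e]
    change _ = w₁ ω.2.2.1 ω.1 / r ω.1
    change 0 < r ω.1 at h4
    change 0 < w₂ (ω.2.2.2.1, ω.1) ω.2.1 at h2
    field_simp
  · rw [Fintype.sum_prod_type]
    simp_rw [Fintype.sum_prod_type (α₁ := 𝒱)]
    simp_rw [Finset.sum_comm (s := (Finset.univ : Finset 𝒱)), ← Finset.mul_sum, hF.w₂_sum,
      mul_one, ← Finset.sum_mul, hF.p_sum, one_mul, hF.r_sum, le_refl]
  · intro ω h0
    obtain ⟨h1, h2, h3⟩ := hF.w_pos h0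
    exact mul_pos (mul_pos h3 (hF.r_pos ω h0)) h2

lemma rate₂_nonneg :
    0 ≤ ∑ ω, q ω * Real.log (w₂ (Y₁ ω, U ω) (V ω) / k (U ω) (V ω)) := by
  have h := sum_mul_log_div_nonneg (q := q)
    (q' := fun ω => p ω.2.2 * w₁ ω.2.2.1 ω.1 * k ω.1 ω.2.1) hF.q_nonneg
    (fun ω => mul_nonneg (mul_nonneg (hF.p_nonneg _) (hF.w₁_nonneg _ _)) (hF.k_nonneg _ _))
    hF.q_sum ?_ ?_
  · refine h.trans_eq (Finset.sum_congr rfl fun ω _ => ?_)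
    rcases (hF.q_nonneg ω).eq_or_lt with h0 | h0
    · simp [← h0]
    obtain ⟨h1, h2, h3⟩ := hF.w_pos h0
    have h4 := hF.k_pos ω h0
    have e := hF.q_eq ω.1 ω.2.1 ω.2.2
    simp only [Prod.mk.eta] at e
    congr 2
    rw [e]
    change _ = w₂ (ω.2.2.2.1, ω.1) ω.2.1 / k ω.1 ω.2.1
    change 0 < k ω.1 ω.2.1 at h4
    change 0 < w₁ ω.2.2.1 ω.1 at h1
    field_simp
  · rw [Fintype.sum_prod_type]
    simp_rw [Fintype.sum_prod_type (α₁ := 𝒱)]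
    simp_rw [Finset.sum_comm (s := (Finset.univ : Finset 𝒱)), ← Finset.mul_sum, hF.k_sum,
      mul_one]
    rw [Finset.sum_comm]
    simp_rw [← Finset.mul_sum, hF.w₁_sum, mul_one, hF.p_sum, le_refl]
  · intro ω h0
    obtain ⟨h1, h2, h3⟩ := hF.w_pos h0
    exact mul_pos (mul_pos h3 h1) (hF.k_pos ω h0)

end Factorization

end Factorization

/-! ### From the two-level code to a scheme -/

section Sequences

lemma sum_rotate {α β γ : Type*} [Fintype α] [Fintype β] [Fintype γ] (F : α → β → γ → ℝ) :
    ∑ a, ∑ b, ∑ c, F a b c = ∑ c, ∑ a, ∑ b, F a b c :=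
  (Finset.sum_comm.trans (Finset.sum_congr rfl fun _ _ => Finset.sum_comm)).symm

variable {𝒰 𝒱 𝒳 𝒴₁ 𝒴₂ : Type*} [Fintype 𝒰] [Fintype 𝒱] [Fintype 𝒳] [Fintype 𝒴₁] [Fintype 𝒴₂]
  {p pbar : 𝒳 × 𝒴₁ × 𝒴₂ → ℝ} {q qbar : Tuple 𝒰 𝒱 𝒳 𝒴₁ 𝒴₂ → ℝ}
  {w₁ : 𝒳 → 𝒰 → ℝ} {w₂ : 𝒴₁ × 𝒰 → 𝒱 → ℝ} {r : 𝒰 → ℝ} {k : 𝒰 → 𝒱 → ℝ}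

/-- Summation over the sequences of tuples in the order of generation. -/
lemma sum_prod_tuple (hq : ∀ u v s, q (u, v, s) = p s * w₁ s.1 u * w₂ (s.2.1, u) v) {n : ℕ}
    (G : (Fin n → 𝒰) → (Fin n → 𝒱) → (Fin n → 𝒳 × 𝒴₁ × 𝒴₂) → ℝ) :
    ∑ s : Fin n → 𝒳 × 𝒴₁ × 𝒴₂, (∏ t, p (s t)) * ∑ u : Fin n → 𝒰, (∏ t, w₁ (s t).1 (u t)) *
        ∑ v : Fin n → 𝒱, (∏ t, w₂ ((s t).2.1, u t) (v t)) * G u v s =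
      ∑ τ : Fin n → Tuple 𝒰 𝒱 𝒳 𝒴₁ 𝒴₂, (∏ t, q (τ t)) *
        G (fun t => (τ t).1) (fun t => (τ t).2.1) fun t => (τ t).2.2 := by
  rw [sum_fun_prod (α := 𝒰)]
  simp_rw [Finset.mul_sum]
  rw [← sum_rotate]
  refine Finset.sum_congr rfl fun u _ => ?_
  rw [sum_fun_prod (α := 𝒱)]
  refine Finset.sum_congr rfl fun v _ => Finset.sum_congr rfl fun s _ => ?_
  simp_rw [hq, Finset.prod_mul_distrib]
  ring

lemma sum_prod_tuple_left (hq : ∀ u v s, q (u, v, s) = p s * w₁ s.1 u * w₂ (s.2.1, u) v)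
    (hw₂ : ∀ b, ∑ v, w₂ b v = 1) {n : ℕ}
    (G : (Fin n → 𝒰) → (Fin n → 𝒳 × 𝒴₁ × 𝒴₂) → ℝ) :
    ∑ s : Fin n → 𝒳 × 𝒴₁ × 𝒴₂, (∏ t, p (s t)) *
        ∑ u : Fin n → 𝒰, (∏ t, w₁ (s t).1 (u t)) * G u s =
      ∑ τ : Fin n → Tuple 𝒰 𝒱 𝒳 𝒴₁ 𝒴₂, (∏ t, q (τ t)) *
        G (fun t => (τ t).1) fun t => (τ t).2.2 := by
  rw [← sum_prod_tuple hq fun u _ s => G u s]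
  simp_rw [← Finset.sum_mul]
  refine Finset.sum_congr rfl fun s _ => congrArg _ (Finset.sum_congr rfl fun u _ => ?_)
  rw [sum_prod_kernel hw₂ fun t => ((s t).2.1, u t), one_mul]

/-- The scheme of a two-level code. -/
noncomputable def codeScheme {n M₁ M₂ : ℕ} (enc₁ : (Fin n → 𝒳) → Option (Fin M₁))
    (enc₂ : Fin M₁ → (Fin n → 𝒴₁) → Option (Fin M₂))
    (D₁ : Fin M₁ → (Fin n → 𝒴₁) → Prop) (D₂ : Fin M₁ → Fin M₂ → (Fin n → 𝒴₂) → Prop) :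
    Scheme 𝒳 𝒴₁ 𝒴₂ n :=
  open scoped Classical in
  { W₁ := M₁ + 1
    W₂ := M₂ + 1
    φ₁ := fun x => (finSuccEquiv M₁).symm (enc₁ x)
    φ₂ := fun m y => (finSuccEquiv M₂).symm ((finSuccEquiv M₁ m).bind fun j => enc₂ j y)
    -- One extra message on each link reports an encoding failure. Detector 1 then declares 0 and
    -- Detector 2 declares 1, so failures count only as type I errors.
    ψ₁ := fun m y => if ∃ j, finSuccEquiv M₁ m = some j ∧ D₁ j y then 1 else 0
    ψ₂ := fun m m' z => if ∃ j, finSuccEquiv M₁ m = some j ∧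
      ∃ i, finSuccEquiv M₂ m' = some i ∧ D₂ j i z then 0 else 1 }

omit [Fintype 𝒳] [Fintype 𝒴₁] [Fintype 𝒴₂] in
lemma codeScheme_guess {n M₁ M₂ : ℕ} (enc₁ : (Fin n → 𝒳) → Option (Fin M₁))
    (enc₂ : Fin M₁ → (Fin n → 𝒴₁) → Option (Fin M₂))
    (D₁ : Fin M₁ → (Fin n → 𝒴₁) → Prop) (D₂ : Fin M₁ → Fin M₂ → (Fin n → 𝒴₂) → Prop)
    (s : Fin n → 𝒳 × 𝒴₁ × 𝒴₂) :
    ((codeScheme enc₁ enc₂ D₁ D₂).guess₁ s = 1 ↔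
      ∃ j, enc₁ (fun t => (s t).1) = some j ∧ D₁ j fun t => (s t).2.1) ∧
    ((codeScheme enc₁ enc₂ D₁ D₂).guess₂ s = 0 ↔ ∃ j, enc₁ (fun t => (s t).1) = some j ∧
      ∃ i, enc₂ j (fun t => (s t).2.1) = some i ∧ D₂ j i fun t => (s t).2.2) := by
  constructor
  · simp [Scheme.guess₁, codeScheme]
  · simp only [Scheme.guess₂, codeScheme, Equiv.apply_symm_apply]
    rcases enc₁ fun t => (s t).1 with _ | j
    · simp
    · simp

variable {P Pbar : PMF (𝒳 × 𝒴₁ × 𝒴₂)}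

/-- `exists_code` on blocks of length `n`. The constants `K₁`, `K₂` govern covering; `N₁`, `N₂`
bound the codeword law by the test channel on typical pairs. After this change of measure every
quantity is a probability under the product of `q` or `qbar`. -/
theorem Factorization.exists_scheme
    (hF : Factorization (wt P) (wt Pbar) q qbar w₁ w₂ r k) {n : ℕ}
    (B₁ : (Fin n → 𝒰) → (Fin n → 𝒳) → Prop) (B₂ : (Fin n → 𝒰) → (Fin n → 𝒱) → (Fin n → 𝒴₁) → Prop)
    (A₃ : (Fin n → 𝒰) → (Fin n → 𝒱) → (Fin n → 𝒴₂) → Prop)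
    (A₄ : (Fin n → 𝒰) → (Fin n → 𝒴₁) → Prop)
    (A₁ : (Fin n → 𝒰) → (Fin n → 𝒳) → Prop) (A₂ : (Fin n → 𝒰) → (Fin n → 𝒱) → (Fin n → 𝒴₁) → Prop)
    {K₁ K₂ N₁ N₂ : ℝ} (hK₁ : 0 < K₁) (hK₂ : 0 < K₂) (hN₁ : 0 ≤ N₁) (hN₂ : 0 ≤ N₂)
    (hA₁ : ∀ u x, A₁ u x → ((∏ t, w₁ (x t) (u t)) ≤ K₁ * ∏ t, r (u t)) ∧
      ((∏ t, r (u t)) ≤ N₁ * ∏ t, w₁ (x t) (u t)) ∧ B₁ u x)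
    (hA₂ : ∀ u v y, A₂ u v y → ((∏ t, w₂ (y t, u t) (v t)) ≤ K₂ * ∏ t, k (u t) (v t)) ∧
      ((∏ t, k (u t) (v t)) ≤ N₂ * ∏ t, w₂ (y t, u t) (v t)) ∧ B₂ u v y)
    {η : ℝ} (hη : 0 < η) {l₁ l₂ : ℝ} (hl₁ : 0 < l₁) (hl₂ : 0 < l₂) (M₁ M₂ : ℕ) {Δ : ℝ}
    (hΔ : (∑ τ : Fin n → Tuple 𝒰 𝒱 𝒳 𝒴₁ 𝒴₂, (∏ t, q (τ t)) *
          ind (¬ A₁ (fun t => U (τ t)) fun t => X (τ t))) +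
        (η ^ 2)⁻¹ * ((∑ τ : Fin n → Tuple 𝒰 𝒱 𝒳 𝒴₁ 𝒴₂, (∏ t, q (τ t)) *
            ind (¬ (A₂ (fun t => U (τ t)) (fun t => V (τ t)) (fun t => Y₁ (τ t)) ∧
              A₃ (fun t => U (τ t)) (fun t => V (τ t)) (fun t => Y₂ (τ t))))) +
          ∑ τ : Fin n → Tuple 𝒰 𝒱 𝒳 𝒴₁ 𝒴₂, (∏ t, qbar (τ t)) *
            ind (¬ A₄ (fun t => U (τ t)) fun t => Y₁ (τ t))) +
        Real.exp (-(M₁ / K₁)) + Real.exp (-(M₂ / K₂)) + 2 * η + 2 * η ^ 2 +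
        l₁ * (M₁ * (N₁ * ∑ τ : Fin n → Tuple 𝒰 𝒱 𝒳 𝒴₁ 𝒴₂, (∏ t, q (τ t)) *
          ind (B₁ (fun t => U (τ t)) (fun t => X (τ t)) ∧
            A₄ (fun t => U (τ t)) fun t => Y₁ (τ t)))) +
        l₂ * (M₁ * M₂ * (N₁ * N₂ * ∑ τ : Fin n → Tuple 𝒰 𝒱 𝒳 𝒴₁ 𝒴₂, (∏ t, qbar (τ t)) *
          ind (B₁ (fun t => U (τ t)) (fun t => X (τ t)) ∧
            B₂ (fun t => U (τ t)) (fun t => V (τ t)) (fun t => Y₁ (τ t)) ∧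
            A₃ (fun t => U (τ t)) (fun t => V (τ t)) fun t => Y₂ (τ t)))) ≤ Δ) :
    ∃ c : Scheme 𝒳 𝒴₁ 𝒴₂ n, c.W₁ = M₁ + 1 ∧ c.W₂ = M₂ + 1 ∧
      typeI₁ 0 P Pbar c ≤ ENNReal.ofReal Δ ∧ typeI₂ P Pbar c ≤ ENNReal.ofReal Δ ∧
      typeII₁ 0 P Pbar c ≤ ENNReal.ofReal (Δ / l₁) ∧
      typeII₂ P Pbar c ≤ ENNReal.ofReal (Δ / l₂) := by
  have hw₁0 : ∀ (x : Fin n → 𝒳) (u : Fin n → 𝒰), 0 ≤ ∏ t, w₁ (x t) (u t) := fun x u =>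
    Finset.prod_nonneg fun t _ => hF.w₁_nonneg _ _
  have hw₂0 : ∀ (y : Fin n → 𝒴₁) (u : Fin n → 𝒰) (v : Fin n → 𝒱),
      0 ≤ ∏ t, w₂ (y t, u t) (v t) := fun y u v => Finset.prod_nonneg fun t _ => hF.w₂_nonneg _ _
  have hr0 : ∀ u : Fin n → 𝒰, 0 ≤ ∏ t, r (u t) := fun u =>
    Finset.prod_nonneg fun t _ => hF.r_nonneg _
  have hk0 : ∀ (u : Fin n → 𝒰) (v : Fin n → 𝒱), 0 ≤ ∏ t, k (u t) (v t) := fun u v =>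
    Finset.prod_nonneg fun t _ => hF.k_nonneg _ _
  have hp0 : ∀ s : Fin n → 𝒳 × 𝒴₁ × 𝒴₂, 0 ≤ ∏ t, wt P (s t) := fun s =>
    Finset.prod_nonneg fun t _ => wt_nonneg _ _
  have hpb0 : ∀ s : Fin n → 𝒳 × 𝒴₁ × 𝒴₂, 0 ≤ ∏ t, wt Pbar (s t) := fun s =>
    Finset.prod_nonneg fun t _ => wt_nonneg _ _
  -- A word independent of the sources is traded, at the factor `N₁`, for one generated from `x`,
  -- which restores the joint law `q`.
  have hb₁ : ∑ u : Fin n → 𝒰, (∏ t, r (u t)) * ∑ s : Fin n → 𝒳 × 𝒴₁ × 𝒴₂, (∏ t, wt P (s t)) *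
        ind (A₁ u (fun t => (s t).1) ∧ A₄ u fun t => (s t).2.1) ≤
      N₁ * ∑ τ : Fin n → Tuple 𝒰 𝒱 𝒳 𝒴₁ 𝒴₂, (∏ t, q (τ t)) *
        ind (B₁ (fun t => U (τ t)) (fun t => X (τ t)) ∧
          A₄ (fun t => U (τ t)) fun t => Y₁ (τ t)) := by
    refine le_trans ?_ (mul_le_mul_of_nonneg_left (sum_prod_tuple_left hF.q_eq hF.w₂_sum
      (n := n) fun u s => ind (B₁ u (fun t => (s t).1) ∧ A₄ u fun t => (s t).2.1)).le hN₁)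
    simp_rw [Finset.mul_sum]
    rw [Finset.sum_comm]
    refine Finset.sum_le_sum fun s _ => Finset.sum_le_sum fun u _ => ?_
    by_cases h : A₁ u (fun t => (s t).1) ∧ A₄ u fun t => (s t).2.1
    · obtain ⟨-, h1, h2⟩ := hA₁ _ _ h.1
      rw [ind_of h, ind_of ⟨h2, h.2⟩]
      have := mul_le_mul_of_nonneg_left h1 (hp0 s)
      linarith
    · rw [ind_of_not h, mul_zero, mul_zero]
      exact mul_nonneg hN₁ (mul_nonneg (hp0 s) (mul_nonneg (hw₁0 _ _) (ind_nonneg _)))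
  have hb₂ : ∑ u : Fin n → 𝒰, (∏ t, r (u t)) * ∑ v : Fin n → 𝒱, (∏ t, k (u t) (v t)) *
        ∑ s : Fin n → 𝒳 × 𝒴₁ × 𝒴₂, (∏ t, wt Pbar (s t)) *
        ind (A₁ u (fun t => (s t).1) ∧ A₂ u v (fun t => (s t).2.1) ∧
          A₃ u v fun t => (s t).2.2) ≤
      N₁ * N₂ * ∑ τ : Fin n → Tuple 𝒰 𝒱 𝒳 𝒴₁ 𝒴₂, (∏ t, qbar (τ t)) *
        ind (B₁ (fun t => U (τ t)) (fun t => X (τ t)) ∧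
          B₂ (fun t => U (τ t)) (fun t => V (τ t)) (fun t => Y₁ (τ t)) ∧
          A₃ (fun t => U (τ t)) (fun t => V (τ t)) fun t => Y₂ (τ t)) := by
    refine le_trans ?_ (mul_le_mul_of_nonneg_left (sum_prod_tuple hF.qbar_eq
      (n := n) fun u v s => ind (B₁ u (fun t => (s t).1) ∧ B₂ u v (fun t => (s t).2.1) ∧
        A₃ u v fun t => (s t).2.2)).le (mul_nonneg hN₁ hN₂))
    simp_rw [Finset.mul_sum]
    rw [sum_rotate]
    refine Finset.sum_le_sum fun s _ => Finset.sum_le_sum fun u _ =>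
      Finset.sum_le_sum fun v _ => ?_
    have hwv := hw₂0 (fun t => (s t).2.1) u v
    have hwu := hw₁0 (fun t => (s t).1) u
    by_cases h : A₁ u (fun t => (s t).1) ∧ A₂ u v (fun t => (s t).2.1) ∧ A₃ u v fun t => (s t).2.2
    · obtain ⟨-, h1, h2⟩ := hA₁ _ _ h.1
      obtain ⟨-, h3, h4⟩ := hA₂ _ _ _ h.2.1
      rw [ind_of h, ind_of ⟨h2, h4, h.2.2⟩]
      have h5 := mul_le_mul h1 h3 (hk0 u v) (mul_nonneg hN₁ hwu)
      have := mul_le_mul_of_nonneg_left h5 (hpb0 s)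
      linarith
    · rw [ind_of_not h, mul_zero, mul_zero, mul_zero]
      exact mul_nonneg (mul_nonneg hN₁ hN₂) (mul_nonneg (hpb0 s)
        (mul_nonneg hwu (mul_nonneg hwv (ind_nonneg _))))
  have hX : ∀ x : Fin n → 𝒳,
      ∑ s : Fin n → 𝒳 × 𝒴₁ × 𝒴₂, ind ((fun t => (s t).1) = x) * ∏ t, wt P (s t) =
      ∑ s : Fin n → 𝒳 × 𝒴₁ × 𝒴₂, ind ((fun t => (s t).1) = x) * ∏ t, wt Pbar (s t) := by
    intro x
    simp_rw [mul_comm (ind _)]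
    have h := sum_iid_push (n := n) (wt P) (Prod.fst (α := 𝒳)) fun x' => ind (x' = x)
    have h' := sum_iid_push (n := n) (wt Pbar) (Prod.fst (α := 𝒳)) fun x' => ind (x' = x)
    rw [h, h', funext hF.p_marginal]
  obtain ⟨enc₁, enc₂, C₁, C₂, h1, h2, h3, h4⟩ := exists_code
    (fun (s : Fin n → 𝒳 × 𝒴₁ × 𝒴₂) t => (s t).1) (fun s t => (s t).2.1) (fun s t => (s t).2.2)
    (fun s => ∏ t, wt P (s t)) (fun s => ∏ t, wt Pbar (s t)) hp0 hpb0 (sum_iid hF.p_sum n) hX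
    (fun x (u : Fin n → 𝒰) => ∏ t, w₁ (x t) (u t)) hw₁0 (fun x => sum_prod_kernel hF.w₁_sum x)
    (fun y u (v : Fin n → 𝒱) => ∏ t, w₂ (y t, u t) (v t)) hw₂0
    (fun y u => sum_prod_kernel hF.w₂_sum fun t => (y t, u t))
    (fun u => ∏ t, r (u t)) hr0 (sum_iid hF.r_sum n)
    (fun u v => ∏ t, k (u t) (v t)) hk0 (fun u => sum_prod_kernel hF.k_sum u)
    A₁ A₂ A₃ A₄ hK₁ hK₂ (fun u x h => (hA₁ u x h).1) (fun u v y h => (hA₂ u v y h).1)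
    hη hl₁.le hl₂.le M₁ M₂ (Δ := Δ) (by
      refine le_trans ?_ hΔ
      rw [sum_prod_tuple_left hF.q_eq hF.w₂_sum fun u s => ind (¬ A₁ u fun t => (s t).1),
        sum_prod_tuple hF.q_eq fun u v s => ind (¬ (A₂ u v (fun t => (s t).2.1) ∧
          A₃ u v fun t => (s t).2.2)),
        sum_prod_tuple_left hF.qbar_eq hF.w₂_sum fun u s => ind (¬ A₄ u fun t => (s t).2.1)]
      have h1 := mul_le_mul_of_nonneg_left (mul_le_mul_of_nonneg_left hb₁
        (Nat.cast_nonneg (α := ℝ) M₁)) hl₁.le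
      have h2 := mul_le_mul_of_nonneg_left (mul_le_mul_of_nonneg_left hb₂
        (mul_nonneg (Nat.cast_nonneg (α := ℝ) M₁) (Nat.cast_nonneg (α := ℝ) M₂))) hl₂.le
      exact add_le_add (add_le_add le_rfl h1) h2)
  have hg := codeScheme_guess enc₁ enc₂ (fun j => A₄ (C₁ j)) fun j i => A₃ (C₁ j) (C₂ j i)
  set c := codeScheme enc₁ enc₂ (fun j => A₄ (C₁ j)) fun j i => A₃ (C₁ j) (C₂ j i) with hc
  have hg₁ : ∀ s, c.guess₁ s = 0 ↔
      ¬ ∃ j, enc₁ (fun t => (s t).1) = some j ∧ A₄ (C₁ j) fun t => (s t).2.1 := by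
    intro s
    rw [← (hg s).1]
    generalize c.guess₁ s = i
    revert i
    decide
  have hg₂ : ∀ s, c.guess₂ s = 1 ↔ ¬ ∃ j, enc₁ (fun t => (s t).1) = some j ∧
      ∃ i, enc₂ j (fun t => (s t).2.1) = some i ∧ A₃ (C₁ j) (C₂ j i) fun t => (s t).2.2 := by
    intro s
    rw [← (hg s).2]
    generalize c.guess₂ s = i
    revert i
    decide
  refine ⟨c, rfl, rfl, ?_, ?_, ?_, ?_⟩
  · rw [typeI₁, iidProb_eq]
    simp only [Set.mem_ofPred_eq, hg₁]
    exact ENNReal.ofReal_le_ofReal h1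
  · rw [typeI₂, iidProb_eq]
    simp only [Set.mem_ofPred_eq, hg₂]
    exact ENNReal.ofReal_le_ofReal h2
  · rw [typeII₁, iidProb_eq]
    simp only [Set.mem_ofPred_eq, zero_add, (hg _).1]
    refine ENNReal.ofReal_le_ofReal ?_
    rw [le_div_iff₀ hl₁, mul_comm]
    exact h3
  · rw [typeII₂, iidProb_eq]
    simp only [Set.mem_ofPred_eq, (hg _).2]
    refine ENNReal.ofReal_le_ofReal ?_
    rw [le_div_iff₀ hl₂, mul_comm]
    exact h4

end Sequences

/-! ### Choice of the parameters and asymptotics -/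

section Asymptotics

lemma tendsto_pow_mul_exp (c : ℕ) (C : ℝ) {ε : ℝ} (hε : 0 < ε) :
    Tendsto (fun n : ℕ => C * (((n : ℝ) + 1) ^ c * Real.exp (-(n * ε)))) atTop (𝓝 0) := by
  have hr : |Real.exp (-ε)| < 1 := by
    rw [abs_of_pos (Real.exp_pos _), Real.exp_lt_one_iff]
    linarith
  have h := (tendsto_add_atTop_iff_nat 1).2 (tendsto_pow_const_mul_const_pow_of_abs_lt_one c hr)
  have h' := h.const_mul (C * Real.exp ε)
  rw [mul_zero] at h'
  refine h'.congr fun n => ?_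
  rw [← Real.exp_nat_mul]
  push_cast
  have : Real.exp ε * Real.exp (((n : ℝ) + 1) * -ε) = Real.exp (-(n * ε)) := by
    rw [← Real.exp_add]
    congr 1
    ring
  rw [← this]
  ring

/-- The margin `2 * δ` exceeds the `I + δ` of covering, so a miss is doubly exponentially rare,
while the change of measure leaves only `3 * δ` in the exponent. The constant `3` absorbs the
rounding and the failure message. -/
lemma codebook_size_bounds {I δ : ℝ} (hI : 0 ≤ I) (hδ : 0 < δ) (n : ℕ) :
    Real.exp (n * δ) ≤ ⌈Real.exp (n * (I + 2 * δ))⌉₊ / Real.exp (n * (I + δ)) ∧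
    ⌈Real.exp (n * (I + 2 * δ))⌉₊ * Real.exp (-(n * (I - δ))) ≤ 2 * Real.exp (n * (3 * δ)) ∧
    Real.log ((⌈Real.exp (n * (I + 2 * δ))⌉₊ + 1 : ℕ) : ℝ) ≤ Real.log 3 + n * (I + 2 * δ) := by
  have h1 : 1 ≤ Real.exp (n * (I + 2 * δ)) := Real.one_le_exp (by positivity)
  have h2 := Nat.le_ceil (Real.exp (n * (I + 2 * δ)))
  have h3 := Nat.ceil_lt_add_one (Real.exp_pos (n * (I + 2 * δ))).le
  refine ⟨?_, ?_, ?_⟩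
  · rw [le_div_iff₀ (Real.exp_pos _), ← Real.exp_add]
    refine le_trans (le_of_eq ?_) h2
    congr 1
    ring
  · have h4 : (⌈Real.exp (n * (I + 2 * δ))⌉₊ : ℝ) ≤ 2 * Real.exp (n * (I + 2 * δ)) := by linarith
    refine (mul_le_mul_of_nonneg_right h4 (Real.exp_pos _).le).trans_eq ?_
    rw [mul_assoc, ← Real.exp_add]
    congr 2
    ring
  · have h4 : ((⌈Real.exp (n * (I + 2 * δ))⌉₊ + 1 : ℕ) : ℝ) ≤
        3 * Real.exp (n * (I + 2 * δ)) := by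
      push_cast
      linarith
    refine (Real.log_le_log (by positivity) h4).trans_eq ?_
    rw [Real.log_mul (by norm_num) (Real.exp_pos _).ne', Real.log_exp]

variable {𝒰 𝒱 𝒳 𝒴₁ 𝒴₂ : Type*} [Fintype 𝒰] [Fintype 𝒱] [Fintype 𝒳] [Fintype 𝒴₁] [Fintype 𝒴₂]
  {P Pbar : PMF (𝒳 × 𝒴₁ × 𝒴₂)} {R₁ R₂ : ℝ} {Q Qbar : PMF (Tuple 𝒰 𝒱 𝒳 𝒴₁ 𝒴₂)}

lemma law₂_U_X_eq (hX : P.map (fun s => s.1) = Pbar.map (fun s => s.1))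
    (hQ : IsAuxiliary P R₁ R₂ Q) (hQbar : IsAlternative Q Pbar Qbar) :
    law₂ Qbar U X = law₂ Q U X := by
  have hmap : Qbar.map X = Q.map X := by
    have e : ∀ R : PMF (Tuple 𝒰 𝒱 𝒳 𝒴₁ 𝒴₂), R.map X = (law₃ R X Y₁ Y₂).map fun s => s.1 := by
      intro R
      rw [law₃, PMF.map_comp]
      rfl
    rw [e, e, hQ.marginal, hQbar.marginal, hX]
  obtain ⟨w, -, -, h1, h2⟩ := exists_kernel hQbar.condU
  refine ext_wt ?_
  rintro ⟨u, x⟩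
  rw [h1, h2, hmap]

/-- Zero distance of both marginals from their targets means membership in `L₁bar`. The sensor tests
`(u, x)` against the law under `Q`, which is also the one under `Qbar` by `law₂_U_X_eq`. -/
theorem exists_exponent₁ (hX : P.map (fun s => s.1) = Pbar.map (fun s => s.1))
    (hQ : IsAuxiliary P R₁ R₂ Q) (hQbar : IsAlternative Q Pbar Qbar) {θ₁ : ℝ}
    (h₁ : ENNReal.ofReal θ₁ ≤ ⨅ T ∈ L₁bar Qbar, kl T (law₃ Q U X Y₁)) {ε : ℝ} (hε : 0 < ε) :
    ∃ δ > 0, ∀ n : ℕ, 0 < n → ∀ E : (Fin n → 𝒰 × 𝒳 × 𝒴₁) → Prop,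
      (∀ s, E s →
        pushDist (fun ω : 𝒰 × 𝒳 × 𝒴₁ => (ω.1, ω.2.1)) (wt (law₂ Q U X)) (emp s) +
          pushDist (fun ω : 𝒰 × 𝒳 × 𝒴₁ => (ω.1, ω.2.2)) (wt (law₂ Qbar U Y₁)) (emp s) ≤ δ) →
      ∑ s : Fin n → 𝒰 × 𝒳 × 𝒴₁, (∏ t, wt (law₃ Q U X Y₁) (s t)) * ind (E s) ≤
        ((n : ℝ) + 1) ^ Fintype.card (𝒰 × 𝒳 × 𝒴₁) * Real.exp (-(n * (θ₁ - ε))) := by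
  exact exists_sum_iid_le (wt_nonneg (law₃ Q U X Y₁))
    (m := fun T => pushDist (fun ω : 𝒰 × 𝒳 × 𝒴₁ => (ω.1, ω.2.1)) (wt (law₂ Q U X)) T +
      pushDist (fun ω : 𝒰 × 𝒳 × 𝒴₁ => (ω.1, ω.2.2)) (wt (law₂ Qbar U Y₁)) T)
    ((continuous_pushDist _ _).add (continuous_pushDist _ _)) (θ := θ₁) (by
      intro T hT hac hm
      obtain ⟨R, hR⟩ := exists_wt_eq hT.1 hT.2
      obtain rfl : wt R = T := funext hR
      refine le_div_of_le_kl (h₁.trans (iInf₂_le R ⟨?_, ?_⟩)) hac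
      · rw [law₂_U_X_eq hX hQ hQbar]
        refine ext_wt fun b => ?_
        rw [← push_eq_of_pushDist_le (T := wt R) (π := fun ω : 𝒰 × 𝒳 × 𝒴₁ => (ω.1, ω.2.1))
          (le_trans (le_add_of_nonneg_right (pushDist_nonneg _ _ _)) hm), ← wt_map_eq_push]
        rfl
      · refine ext_wt fun b => ?_
        rw [← push_eq_of_pushDist_le (T := wt R) (π := fun ω : 𝒰 × 𝒳 × 𝒴₁ => (ω.1, ω.2.2))
          (le_trans (le_add_of_nonneg_left (pushDist_nonneg _ _ _)) hm), ← wt_map_eq_push]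
        rfl) hε

theorem exists_exponent₂ {θ₂ : ℝ} (h₂ : ENNReal.ofReal θ₂ ≤ ⨅ T ∈ L₂ Q, kl T Qbar) {ε : ℝ}
    (hε : 0 < ε) :
    ∃ δ > 0, ∀ n : ℕ, 0 < n → ∀ E : (Fin n → Tuple 𝒰 𝒱 𝒳 𝒴₁ 𝒴₂) → Prop,
      (∀ s, E s → pushDist (fun ω => (U ω, X ω)) (wt (law₂ Q U X)) (emp s) +
        (pushDist (fun ω => (U ω, V ω, Y₁ ω)) (wt (law₃ Q U V Y₁)) (emp s) +
          pushDist (fun ω => (U ω, V ω, Y₂ ω)) (wt (law₃ Q U V Y₂)) (emp s)) ≤ δ) →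
      ∑ s : Fin n → Tuple 𝒰 𝒱 𝒳 𝒴₁ 𝒴₂, (∏ t, wt Qbar (s t)) * ind (E s) ≤
        ((n : ℝ) + 1) ^ Fintype.card (Tuple 𝒰 𝒱 𝒳 𝒴₁ 𝒴₂) * Real.exp (-(n * (θ₂ - ε))) := by
  exact exists_sum_iid_le (wt_nonneg Qbar)
    (m := fun T => pushDist (fun ω => (U ω, X ω)) (wt (law₂ Q U X)) T +
      (pushDist (fun ω => (U ω, V ω, Y₁ ω)) (wt (law₃ Q U V Y₁)) T +
        pushDist (fun ω => (U ω, V ω, Y₂ ω)) (wt (law₃ Q U V Y₂)) T))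
    ((continuous_pushDist _ _).add ((continuous_pushDist _ _).add (continuous_pushDist _ _)))
    (θ := θ₂) (by
      intro T hT hac hm
      obtain ⟨R, hR⟩ := exists_wt_eq hT.1 hT.2
      obtain rfl : wt R = T := funext hR
      have n1 := pushDist_nonneg (fun ω => (U ω, X ω)) (wt (law₂ Q U X)) (wt R)
      have n2 := pushDist_nonneg (fun ω => (U ω, V ω, Y₁ ω)) (wt (law₃ Q U V Y₁)) (wt R)
      have n3 := pushDist_nonneg (fun ω => (U ω, V ω, Y₂ ω)) (wt (law₃ Q U V Y₂)) (wt R)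
      refine le_div_of_le_kl (h₂.trans (iInf₂_le R ⟨?_, ?_, ?_⟩)) hac <;>
        refine ext_wt fun b => ?_
      · rw [← push_eq_of_pushDist_le (T := wt R) (π := fun ω => (U ω, X ω))
          (q := wt (law₂ Q U X)) (by linarith), ← wt_map_eq_push]
        rfl
      · rw [← push_eq_of_pushDist_le (T := wt R) (π := fun ω => (U ω, V ω, Y₁ ω))
          (q := wt (law₃ Q U V Y₁)) (by linarith), ← wt_map_eq_push]
        rfl
      · rw [← push_eq_of_pushDist_le (T := wt R) (π := fun ω => (U ω, V ω, Y₂ ω))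
          (q := wt (law₃ Q U V Y₂)) (by linarith), ← wt_map_eq_push]
        rfl) hε

lemma highProb_near_map {α β : Type*} [Fintype α] [Fintype β] (R : PMF α) (π : α → β) {δ : ℝ}
    (hδ : 0 < δ) : HighProb (wt R) fun _ τ => Near δ (wt (R.map π)) fun t => π (τ t) := by
  rw [wt_map_eq_push]
  exact highProb_near (wt_nonneg R) (sum_wt R) π hδ

lemma log_three_add_le {n : ℕ} {I R δ ε : ℝ} (hn : Real.log 3 ≤ n * (ε / 2)) (hI : I ≤ R)
    (hδ : δ ≤ ε / 24) : Real.log 3 + n * (I + 2 * δ) ≤ n * (R + ε) := by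
  have h1 := mul_le_mul_of_nonneg_left hI (Nat.cast_nonneg (α := ℝ) n)
  have h2 := mul_le_mul_of_nonneg_left hδ (Nat.cast_nonneg (α := ℝ) n)
  have h3 : 0 ≤ Real.log 3 := Real.log_nonneg (by norm_num)
  linarith

/-- Of the margin `ε`, one quarter pays for the codebook excess `D` and one quarter for Sanov's
bound; `ε / 2` remains as exponential decay. -/
lemma weighted_exponent_le {n : ℕ} {θ ε D M N C S g : ℝ} (hMN : M * N ≤ C * Real.exp (n * D))
    (hD : D ≤ ε / 4) (hC : 0 ≤ C) (hg : 0 ≤ g) (hS0 : 0 ≤ S)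
    (hS : S ≤ g * Real.exp (-(n * (θ - ε / 4)))) :
    Real.exp (n * (θ - ε)) * (M * (N * S)) ≤ C * (g * Real.exp (-(n * (ε / 2)))) := by
  rw [← mul_assoc M]
  refine (mul_le_mul_of_nonneg_left (mul_le_mul hMN hS hS0 (by positivity))
    (Real.exp_pos _).le).trans ?_
  have e : Real.exp (n * (θ - ε)) * (Real.exp (n * D) * Real.exp (-(n * (θ - ε / 4)))) ≤
      Real.exp (-(n * (ε / 2))) := by
    rw [← Real.exp_add, ← Real.exp_add]
    refine Real.exp_le_exp.2 ?_
    have := mul_le_mul_of_nonneg_left hD (Nat.cast_nonneg (α := ℝ) n)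
    linarith
  have := mul_le_mul_of_nonneg_left e (mul_nonneg hC hg)
  linarith

/-- The scheme `c` meets the requirements for `θ₁, θ₂` and the rates `R₁, R₂` up to `ε`. -/
structure MeetsUpTo (P Pbar : PMF (𝒳 × 𝒴₁ × 𝒴₂)) (R₁ R₂ θ₁ θ₂ ε : ℝ) {n : ℕ}
    (c : Scheme 𝒳 𝒴₁ 𝒴₂ n) : Prop where
  typeI₁_le : typeI₁ 0 P Pbar c ≤ ENNReal.ofReal ε
  typeI₂_le : typeI₂ P Pbar c ≤ ENNReal.ofReal ε
  typeII₁_le : typeII₁ 0 P Pbar c ≤ ENNReal.ofReal (Real.exp (-(n * (θ₁ - ε))))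
  typeII₂_le : typeII₂ P Pbar c ≤ ENNReal.ofReal (Real.exp (-(n * (θ₂ - ε))))
  log_W₁_le : Real.log c.W₁ ≤ n * (R₁ + ε)
  log_W₂_le : Real.log c.W₂ ≤ n * (R₂ + ε)

theorem eventually_exists_scheme (hX : P.map (fun s => s.1) = Pbar.map (fun s => s.1))
    (hQ : IsAuxiliary P R₁ R₂ Q) (hQbar : IsAlternative Q Pbar Qbar) {θ₁ θ₂ : ℝ}
    (h₁ : ENNReal.ofReal θ₁ ≤ ⨅ T ∈ L₁bar Qbar, kl T (law₃ Q U X Y₁))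
    (h₂ : ENNReal.ofReal θ₂ ≤ ⨅ T ∈ L₂ Q, kl T Qbar) {ε : ℝ} (hε : 0 < ε) :
    ∀ᶠ n in atTop, ∃ c : Scheme 𝒳 𝒴₁ 𝒴₂ n, MeetsUpTo P Pbar R₁ R₂ θ₁ θ₂ ε c := by
  obtain ⟨w₁, w₂, r, k, hF, hR₁, hR₂⟩ := exists_factorization hX hQ hQbar
  have hI₁0 := hF.rate₁_nonneg
  have hI₂0 := hF.rate₂_nonneg
  obtain ⟨I₁, hI₁⟩ : ∃ I, I = ∑ ω, wt Q ω * Real.log (w₁ (X ω) (U ω) / r (U ω)) := ⟨_, rfl⟩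
  obtain ⟨I₂, hI₂⟩ : ∃ I, I = ∑ ω, wt Q ω * Real.log (w₂ (Y₁ ω, U ω) (V ω) / k (U ω) (V ω)) :=
    ⟨_, rfl⟩
  rw [← hI₁] at hR₁ hI₁0
  rw [← hI₂] at hR₂ hI₂0
  -- the exponents
  obtain ⟨δ₁, hδ₁, hS₁⟩ := exists_exponent₁ hX hQ hQbar h₁ (by positivity : 0 < ε / 4)
  obtain ⟨δ₂, hδ₂, hS₂⟩ := exists_exponent₂ h₂ (by positivity : 0 < ε / 4)
  -- Letterwise deviations of `δ` add up to at most the alphabet size times `δ`, so `c * δ` bounds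
  -- the total distance in both tests. The summand `1` makes `c` positive at once.
  obtain ⟨c, hc⟩ : ∃ c : ℝ, c = Fintype.card (𝒰 × 𝒳) + Fintype.card (𝒰 × 𝒴₁) +
      Fintype.card (𝒰 × 𝒱 × 𝒴₁) + Fintype.card (𝒰 × 𝒱 × 𝒴₂) + 1 := ⟨_, rfl⟩
  have hc0 : 0 < c := by rw [hc]; positivity
  -- The two codebooks together lose `6 * δ ≤ ε / 4`, as `weighted_exponent_le` requires.
  obtain ⟨δ, hδ, hδε, hδδ₁, hδδ₂⟩ : ∃ δ > 0, δ ≤ ε / 24 ∧ c * δ ≤ δ₁ ∧ c * δ ≤ δ₂ := by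
    refine ⟨min (ε / 24) (min (δ₁ / c) (δ₂ / c)), by positivity, min_le_left _ _, ?_, ?_⟩
    · rw [mul_comm, ← le_div_iff₀ hc0]
      exact (min_le_right _ _).trans (min_le_left _ _)
    · rw [mul_comm, ← le_div_iff₀ hc0]
      exact (min_le_right _ _).trans (min_le_right _ _)
  obtain ⟨Δ, hΔ0, hΔε, hΔ1⟩ : ∃ Δ > 0, Δ ≤ ε ∧ Δ ≤ 1 :=
    ⟨min ε 1, by positivity, min_le_left _ _, min_le_right _ _⟩
  -- typicality
  let B₁ : ∀ n, (Fin n → 𝒰) → (Fin n → 𝒳) → Prop := fun n u x =>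
    Near δ (wt (law₂ Q U X)) fun t => (u t, x t)
  let B₂ : ∀ n, (Fin n → 𝒰) → (Fin n → 𝒱) → (Fin n → 𝒴₁) → Prop := fun n u v y =>
    Near δ (wt (law₃ Q U V Y₁)) fun t => (u t, v t, y t)
  let A₃ : ∀ n, (Fin n → 𝒰) → (Fin n → 𝒱) → (Fin n → 𝒴₂) → Prop := fun n u v z =>
    Near δ (wt (law₃ Q U V Y₂)) fun t => (u t, v t, z t)
  let A₄ : ∀ n, (Fin n → 𝒰) → (Fin n → 𝒴₁) → Prop := fun n u y =>
    Near δ (wt (law₂ Qbar U Y₁)) fun t => (u t, y t)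
  let A₁ : ∀ n, (Fin n → 𝒰) → (Fin n → 𝒳) → Prop := fun n u x =>
    ((∏ t, w₁ (x t) (u t)) ≤ Real.exp (n * (I₁ + δ)) * ∏ t, r (u t)) ∧
    ((∏ t, r (u t)) ≤ Real.exp (-(n * (I₁ - δ))) * ∏ t, w₁ (x t) (u t)) ∧ B₁ n u x
  let A₂ : ∀ n, (Fin n → 𝒰) → (Fin n → 𝒱) → (Fin n → 𝒴₁) → Prop := fun n u v y =>
    ((∏ t, w₂ (y t, u t) (v t)) ≤ Real.exp (n * (I₂ + δ)) * ∏ t, k (u t) (v t)) ∧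
    ((∏ t, k (u t) (v t)) ≤ Real.exp (-(n * (I₂ - δ))) * ∏ t, w₂ (y t, u t) (v t)) ∧ B₂ n u v y
  have he₁ : HighProb (wt Q) fun n τ => A₁ n (fun t => U (τ t)) fun t => X (τ t) := by
    refine ((highProb_prod_le hF.q_nonneg hF.q_sum
      (fun ω hω => ⟨(hF.w_pos hω).1, hF.r_pos ω hω⟩) hI₁ hδ).and hF.q_nonneg
      (highProb_near_map Q (hδ := hδ) fun ω => (U ω, X ω))).mono hF.q_nonneg ?_
    rintro n τ - ⟨⟨h1, h2⟩, h3⟩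
    exact ⟨h1, h2, h3⟩
  have he₂ : HighProb (wt Q) fun n τ =>
      A₂ n (fun t => U (τ t)) (fun t => V (τ t)) (fun t => Y₁ (τ t)) ∧
      A₃ n (fun t => U (τ t)) (fun t => V (τ t)) fun t => Y₂ (τ t) := by
    refine (((highProb_prod_le hF.q_nonneg hF.q_sum
      (fun ω hω => ⟨(hF.w_pos hω).2.1, hF.k_pos ω hω⟩) hI₂ hδ).and hF.q_nonneg
      (highProb_near_map Q (hδ := hδ) fun ω => (U ω, V ω, Y₁ ω))).and hF.q_nonneg
      (highProb_near_map Q (hδ := hδ) fun ω => (U ω, V ω, Y₂ ω))).mono hF.q_nonneg ?_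
    rintro n τ - ⟨⟨⟨h1, h2⟩, h3⟩, h4⟩
    exact ⟨⟨h1, h2, h3⟩, h4⟩
  have he₃ : HighProb (wt Qbar) fun n τ => A₄ n (fun t => U (τ t)) fun t => Y₁ (τ t) :=
    highProb_near_map Qbar (fun ω => (U ω, Y₁ ω)) hδ
  obtain ⟨η, hη, hηΔ⟩ : ∃ η > 0, 2 * η + 2 * η ^ 2 ≤ Δ / 2 :=
    ⟨Δ / 8, by positivity, by nlinarith⟩
  have hexp : Tendsto (fun n : ℕ => Real.exp (-Real.exp (n * δ))) atTop (𝓝 0) :=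
    Real.tendsto_exp_neg_atTop_nhds_zero.comp (Real.tendsto_exp_atTop.comp
      (tendsto_natCast_atTop_atTop.atTop_mul_const hδ))
  -- Everything in the error budget except the terms in `η` tends to `0`, so it is eventually below
  -- the other half of `Δ`.
  have hlim := ((((he₁.add ((he₂.add he₃).const_mul (η ^ 2)⁻¹)).add hexp).add hexp).add
    (tendsto_pow_mul_exp (Fintype.card (𝒰 × 𝒳 × 𝒴₁)) 2 (half_pos hε))).add
    (tendsto_pow_mul_exp (Fintype.card (Tuple 𝒰 𝒱 𝒳 𝒴₁ 𝒴₂)) 4 (half_pos hε))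
  simp only [add_zero, mul_zero] at hlim
  have hlog : ∀ᶠ n : ℕ in atTop, Real.log 3 ≤ n * (ε / 2) :=
    (tendsto_natCast_atTop_atTop.atTop_mul_const (half_pos hε)).eventually_ge_atTop _
  filter_upwards [hlim.eventually_le_const (half_pos hΔ0), hlog, eventually_gt_atTop 0]
    with n hn hn3 hn0
  obtain ⟨hM₁, hMN₁, hW₁⟩ := codebook_size_bounds hI₁0 hδ n
  obtain ⟨hM₂, hMN₂, hW₂⟩ := codebook_size_bounds hI₂0 hδ n
  set M₁ := ⌈Real.exp (n * (I₁ + 2 * δ))⌉₊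
  set M₂ := ⌈Real.exp (n * (I₂ + 2 * δ))⌉₊
  have hs₁ : ∑ τ : Fin n → Tuple 𝒰 𝒱 𝒳 𝒴₁ 𝒴₂, (∏ t, wt Q (τ t)) *
      ind (B₁ n (fun t => U (τ t)) (fun t => X (τ t)) ∧
        A₄ n (fun t => U (τ t)) fun t => Y₁ (τ t)) ≤
      ((n : ℝ) + 1) ^ Fintype.card (𝒰 × 𝒳 × 𝒴₁) * Real.exp (-(n * (θ₁ - ε / 4))) := by
    have e := sum_iid_push (n := n) (wt Q) (fun ω => (U ω, X ω, Y₁ ω)) fun σ =>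
      ind (B₁ n (fun t => (σ t).1) (fun t => (σ t).2.1) ∧
        A₄ n (fun t => (σ t).1) fun t => (σ t).2.2)
    rw [← wt_map_eq_push] at e
    refine e.trans_le (hS₁ n hn0 _ ?_)
    rintro σ ⟨h1, h2⟩
    have h3 := Near.pushDist_emp_le hn0 (π := fun ω : 𝒰 × 𝒳 × 𝒴₁ => (ω.1, ω.2.1)) h1
    have h4 := Near.pushDist_emp_le hn0 (π := fun ω : 𝒰 × 𝒳 × 𝒴₁ => (ω.1, ω.2.2)) h2
    refine (add_le_add h3 h4).trans (le_trans ?_ hδδ₁)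
    rw [← add_mul]
    refine mul_le_mul_of_nonneg_right ?_ hδ.le
    rw [hc]
    have : (0 : ℝ) ≤ Fintype.card (𝒰 × 𝒱 × 𝒴₁) + Fintype.card (𝒰 × 𝒱 × 𝒴₂) := by positivity
    linarith
  have hs₂ : ∑ τ : Fin n → Tuple 𝒰 𝒱 𝒳 𝒴₁ 𝒴₂, (∏ t, wt Qbar (τ t)) *
      ind (B₁ n (fun t => U (τ t)) (fun t => X (τ t)) ∧
        B₂ n (fun t => U (τ t)) (fun t => V (τ t)) (fun t => Y₁ (τ t)) ∧
        A₃ n (fun t => U (τ t)) (fun t => V (τ t)) fun t => Y₂ (τ t)) ≤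
      ((n : ℝ) + 1) ^ Fintype.card (Tuple 𝒰 𝒱 𝒳 𝒴₁ 𝒴₂) *
        Real.exp (-(n * (θ₂ - ε / 4))) := by
    refine hS₂ n hn0 _ ?_
    rintro τ ⟨h1, h2, h3⟩
    have h4 := Near.pushDist_emp_le hn0 (π := fun ω => (U ω, X ω)) h1
    have h5 := Near.pushDist_emp_le hn0 (π := fun ω => (U ω, V ω, Y₁ ω)) h2
    have h6 := Near.pushDist_emp_le hn0 (π := fun ω => (U ω, V ω, Y₂ ω)) h3
    refine (add_le_add h4 (add_le_add h5 h6)).trans (le_trans ?_ hδδ₂)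
    rw [← add_mul, ← add_mul]
    refine mul_le_mul_of_nonneg_right ?_ hδ.le
    rw [hc]
    have : (0 : ℝ) ≤ Fintype.card (𝒰 × 𝒴₁) := by positivity
    linarith
  have ht₁ : Real.exp (n * (θ₁ - ε)) * (M₁ * (Real.exp (-(n * (I₁ - δ))) *
      ∑ τ : Fin n → Tuple 𝒰 𝒱 𝒳 𝒴₁ 𝒴₂, (∏ t, wt Q (τ t)) *
      ind (B₁ n (fun t => U (τ t)) (fun t => X (τ t)) ∧
        A₄ n (fun t => U (τ t)) fun t => Y₁ (τ t)))) ≤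
      2 * (((n : ℝ) + 1) ^ Fintype.card (𝒰 × 𝒳 × 𝒴₁) * Real.exp (-(n * (ε / 2)))) :=
    weighted_exponent_le hMN₁ (by linarith) (by norm_num) (by positivity)
      (Finset.sum_nonneg fun τ _ =>
        mul_nonneg (Finset.prod_nonneg fun t _ => wt_nonneg _ _) (ind_nonneg _)) hs₁
  have hMN : (M₁ : ℝ) * M₂ * (Real.exp (-(n * (I₁ - δ))) * Real.exp (-(n * (I₂ - δ)))) ≤
      4 * Real.exp (n * (6 * δ)) := by
    rw [mul_mul_mul_comm]
    refine (mul_le_mul hMN₁ hMN₂ (by positivity) (by positivity)).trans_eq ?_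
    rw [mul_mul_mul_comm, ← Real.exp_add]
    norm_num
    ring
  have ht₂ : Real.exp (n * (θ₂ - ε)) * (M₁ * M₂ *
      (Real.exp (-(n * (I₁ - δ))) * Real.exp (-(n * (I₂ - δ))) *
      ∑ τ : Fin n → Tuple 𝒰 𝒱 𝒳 𝒴₁ 𝒴₂, (∏ t, wt Qbar (τ t)) *
      ind (B₁ n (fun t => U (τ t)) (fun t => X (τ t)) ∧
        B₂ n (fun t => U (τ t)) (fun t => V (τ t)) (fun t => Y₁ (τ t)) ∧
        A₃ n (fun t => U (τ t)) (fun t => V (τ t)) fun t => Y₂ (τ t)))) ≤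
      4 * (((n : ℝ) + 1) ^ Fintype.card (Tuple 𝒰 𝒱 𝒳 𝒴₁ 𝒴₂) *
        Real.exp (-(n * (ε / 2)))) :=
    weighted_exponent_le hMN (by linarith) (by norm_num) (by positivity)
      (Finset.sum_nonneg fun τ _ =>
        mul_nonneg (Finset.prod_nonneg fun t _ => wt_nonneg _ _) (ind_nonneg _)) hs₂
  have hx₁ : Real.exp (-(M₁ / Real.exp (n * (I₁ + δ)))) ≤ Real.exp (-Real.exp (n * δ)) :=
    Real.exp_le_exp.2 (neg_le_neg hM₁)
  have hx₂ : Real.exp (-(M₂ / Real.exp (n * (I₂ + δ)))) ≤ Real.exp (-Real.exp (n * δ)) :=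
    Real.exp_le_exp.2 (neg_le_neg hM₂)
  -- With the weights `exp (n (θᵢ - ε))`, the bound `Δ ≤ 1` on a weighted type II error is the
  -- desired exponent.
  obtain ⟨c, hcW₁, hcW₂, g1, g2, g3, g4⟩ := hF.exists_scheme (B₁ n) (B₂ n) (A₃ n) (A₄ n) (A₁ n)
    (A₂ n) (Real.exp_pos _) (Real.exp_pos _) (Real.exp_pos _).le (Real.exp_pos _).le
    (fun _ _ h => h) (fun _ _ _ h => h) hη (Real.exp_pos (n * (θ₁ - ε)))
    (Real.exp_pos (n * (θ₂ - ε))) M₁ M₂ (Δ := Δ) (by linarith)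
  have hdiv : ∀ y : ℝ, Δ / Real.exp y ≤ Real.exp (-y) := fun y => by
    rw [Real.exp_neg, div_eq_mul_inv]
    exact mul_le_of_le_one_left (by positivity) hΔ1
  refine ⟨c, g1.trans (ENNReal.ofReal_le_ofReal hΔε), g2.trans (ENNReal.ofReal_le_ofReal hΔε),
    g3.trans (ENNReal.ofReal_le_ofReal (hdiv _)), g4.trans (ENNReal.ofReal_le_ofReal (hdiv _)),
    ?_, ?_⟩
  · rw [hcW₁]
    exact hW₁.trans (log_three_add_le hn3 hR₁ hδε)
  · rw [hcW₂]
    exact hW₂.trans (log_three_add_le hn3 hR₂ hδε)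

end Asymptotics

/-! ### Achievability -/

/-- Let `k n` be the largest `k ≤ n` whose threshold has been reached by `n`; it tends to infinity
since each threshold is finite. -/
lemma exists_diagonal {p : ℕ → ℕ → Prop} (h : ∀ k, ∀ᶠ n in atTop, p k n) :
    ∃ k : ℕ → ℕ, Tendsto k atTop atTop ∧ ∀ᶠ n in atTop, p (k n) n := by
  classical
  simp only [eventually_atTop] at h
  choose N hN using h
  refine ⟨fun n => Nat.findGreatest (fun k => N k ≤ n) n, ?_, ?_⟩
  · refine tendsto_atTop.2 fun K => ?_
    filter_upwards [eventually_ge_atTop K, eventually_ge_atTop (N K)] with n h1 h2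
    exact Nat.le_findGreatest h1 h2
  · filter_upwards [eventually_ge_atTop (N 0)] with n hn
    exact hN _ _ (Nat.findGreatest_spec (P := fun k => N k ≤ n) (Nat.zero_le n) hn)

lemma le_liminf_neg_log_div {b : ℕ → ℝ≥0∞} {θ : ℝ} {ε : ℕ → ℝ} (hε : Tendsto ε atTop (𝓝 0))
    (h : ∀ᶠ n : ℕ in atTop, b n ≤ ENNReal.ofReal (Real.exp (-(n * (θ - ε n))))) :
    (θ : EReal) ≤ liminf (fun n : ℕ => -ENNReal.log (b n) / (n : EReal)) atTop := by
  have hlim : Tendsto (fun n => ((θ - ε n : ℝ) : EReal)) atTop (𝓝 (θ : EReal)) := by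
    refine (continuous_coe_real_ereal.tendsto θ).comp ?_
    simpa using hε.const_sub θ
  rw [← hlim.liminf_eq]
  refine liminf_le_liminf ?_
  filter_upwards [h, eventually_gt_atTop 0] with n hn hn0
  have hn0' : (0 : ℝ) < n := by exact_mod_cast hn0
  have h1 : ENNReal.log (b n) ≤ ((-(n * (θ - ε n)) : ℝ) : EReal) := by
    refine (ENNReal.log_monotone hn).trans_eq ?_
    rw [ENNReal.log_ofReal_of_pos (Real.exp_pos _), Real.log_exp]
  rw [EReal.le_div_iff_mul_le (by exact_mod_cast hn0) (EReal.natCast_ne_top n)]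
  refine le_trans (le_of_eq ?_) (EReal.neg_le_neg_iff.2 h1)
  rw [← EReal.coe_neg, neg_neg, ← EReal.coe_coe_eq_natCast, ← EReal.coe_mul, mul_comm]

lemma limsup_log_div_le {W : ℕ → ℕ} {R : ℝ} {ε : ℕ → ℝ} (hε : Tendsto ε atTop (𝓝 0))
    (h : ∀ᶠ n : ℕ in atTop, Real.log (W n) ≤ n * (R + ε n)) :
    limsup (fun n => ((Real.log (W n) / n : ℝ) : EReal)) atTop ≤ (R : EReal) := by
  have hlim : Tendsto (fun n => ((R + ε n : ℝ) : EReal)) atTop (𝓝 (R : EReal)) := by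
    refine (continuous_coe_real_ereal.tendsto R).comp ?_
    simpa using hε.const_add R
  rw [← hlim.limsup_eq]
  refine limsup_le_limsup ?_
  filter_upwards [h, eventually_gt_atTop 0] with n hn hn0
  have hn0' : (0 : ℝ) < n := by exact_mod_cast hn0
  refine EReal.coe_le_coe_iff.2 ?_
  rw [div_le_iff₀ hn0', mul_comm]
  exact hn

lemma limsup_le_zero {a : ℕ → ℝ≥0∞} {ε : ℕ → ℝ} (hε : Tendsto ε atTop (𝓝 0))
    (h : ∀ᶠ n : ℕ in atTop, a n ≤ ENNReal.ofReal (ε n)) : limsup a atTop ≤ 0 := by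
  have hlim : Tendsto (fun n => ENNReal.ofReal (ε n)) atTop (𝓝 0) := by
    simpa using ENNReal.tendsto_ofReal hε
  rw [← hlim.limsup_eq]
  exact limsup_le_limsup h

end DHT

theorem mainTheorem7 {𝒳 𝒴₁ 𝒴₂ 𝒰 𝒱 : Type*}
    [Fintype 𝒳] [Fintype 𝒴₁] [Fintype 𝒴₂] [Fintype 𝒰] [Fintype 𝒱]
    (P Pbar : PMF (𝒳 × 𝒴₁ × 𝒴₂))
    (hX : P.map (fun s => s.1) = Pbar.map (fun s => s.1))
    (R₁ R₂ : ℝ) (hR₁ : 0 ≤ R₁) (hR₂ : 0 ≤ R₂)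
    (Q Qbar : PMF (DHT.Tuple 𝒰 𝒱 𝒳 𝒴₁ 𝒴₂))
    (hQ : DHT.IsAuxiliary P R₁ R₂ Q)
    (hQbar : DHT.IsAlternative Q Pbar Qbar)
    (θ₁ θ₂ : ℝ) (hθ₁ : 0 ≤ θ₁) (hθ₂ : 0 ≤ θ₂)
    (h₁ : ENNReal.ofReal θ₁ ≤
      ⨅ T ∈ DHT.L₁bar Qbar, DHT.kl T (DHT.law₃ Q DHT.U DHT.X DHT.Y₁))
    (h₂ : ENNReal.ofReal θ₂ ≤ ⨅ T ∈ DHT.L₂ Q, DHT.kl T Qbar) :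
    (θ₁, θ₂) ∈ DHT.exponentsRegion 0 P Pbar R₁ R₂ := by
  refine subset_closure ?_
  obtain ⟨k, hk, hev⟩ := DHT.exists_diagonal fun k : ℕ =>
    DHT.eventually_exists_scheme hX hQ hQbar h₁ h₂ (ε := 1 / ((k : ℝ) + 1)) (by positivity)
  have hε : Tendsto (fun n => 1 / ((k n : ℝ) + 1)) atTop (nhds 0) :=
    tendsto_one_div_add_atTop_nhds_zero_nat.comp hk
  -- A scheme is required at every blocklength; where no good one exists, `Classical.epsilon`
  -- returns an arbitrary one, which does not affect the limits.
  have : ∀ n, Nonempty (DHT.Scheme 𝒳 𝒴₁ 𝒴₂ n) := fun n =>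
    ⟨⟨1, 1, fun _ => 0, fun _ _ => 0, fun _ _ => 0, fun _ _ _ => 0⟩⟩
  have hev' : ∀ᶠ n in atTop, DHT.MeetsUpTo P Pbar R₁ R₂ θ₁ θ₂ (1 / ((k n : ℝ) + 1))
      (Classical.epsilon fun c : DHT.Scheme 𝒳 𝒴₁ 𝒴₂ n =>
        DHT.MeetsUpTo P Pbar R₁ R₂ θ₁ θ₂ (1 / ((k n : ℝ) + 1)) c) :=
    hev.mono fun n hn => Classical.epsilon_spec hn
  exact ⟨_, DHT.limsup_le_zero hε (hev'.mono fun n h => h.typeI₁_le),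
    DHT.limsup_le_zero hε (hev'.mono fun n h => h.typeI₂_le),
    DHT.le_liminf_neg_log_div hε (hev'.mono fun n h => h.typeII₁_le),
    DHT.le_liminf_neg_log_div hε (hev'.mono fun n h => h.typeII₂_le),
    DHT.limsup_log_div_le hε (hev'.mono fun n h => h.log_W₁_le),
    DHT.limsup_log_div_le hε (hev'.mono fun n h => h.log_W₂_le)⟩
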